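/- Let $M\geqslant 4$, let $\mathbb{P}=\mathbb{P}^M$ be the complex projective space of dimension $M$, and let $\mathcal{W}=\mathbb{P}(H^0(\mathbb{P},\mathcal{O}_{\mathbb{P}}(2M)))$ be the projective space of hypersurfaces of degree $2M$ in $\mathbb{P}$, that is, of nonzero homogeneous polynomials of degree $2M$ in $M+1$ variables up to a scalar factor. A point $p$ of a hypersurface $W$ is called a quadratic singularity of rank $r$ if, in an affine chart with coordinates centred at $p$, the equation of $W$ is of the form $q_2+q_3+\cdots$, where $q_k$ is homogeneous of degree $k$ in the $M$ affine coordinates and $q_2$ is a nonzero quadratic form of rank $r$. Then there is a Zariski open subset $\mathcal{W}_{\rm reg}\subset\mathcal{W}$ such that every hypersurface $W\in\mathcal{W}_{\rm reg}$ has finitely many singular points, each of which is a quadratic singularity of rank at least $3$, and, moreover, the following estimate holds: $$ \operatorname{codim}\bigl((\mathcal{W}\setminus\mathcal{W}_{\rm reg})\subset\mathcal{W}\bigr)\geqslant\frac{(M-2)(M-1)}{2}+1 . $$ Here the codimension is taken in the Zariski topology; the codimension of the empty set is $\infty$. -/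

import Mathlib

open scoped LinearAlgebra.Projectivization

noncomputable section

namespace FanoDouble

/-! ### The Zariski topology on a projective space and codimension -/

section Zariski

variable {K V : Type*} [Field K] [AddCommGroup V] [Module K V]

/-- Evaluation at `v : V` of a polynomial in the linear functions on `V`. -/
def evalAt (v : V) (F : MvPolynomial (Module.Dual K V) K) : K :=
  MvPolynomial.eval (fun φ : Module.Dual K V => φ v) F

/-- The common zero locus in `ℙ K V` of a set of polynomial functions on `V`. It is only used for
homogeneous polynomials, for which it does not depend on the representatives. -/
def zeroLocus (S : Set (MvPolynomial (Module.Dual K V) K)) : Set (ℙ K V) :=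
  {x | ∀ F ∈ S, evalAt x.rep F = 0}

/-- The algebraic subsets of `ℙ K V`: common zero loci of homogeneous polynomials. -/
def IsAlgebraicSet (Z : Set (ℙ K V)) : Prop :=
  ∃ S : Set (MvPolynomial (Module.Dual K V) K),
    (∀ F ∈ S, ∃ n : ℕ, F.IsHomogeneous n) ∧ Z = zeroLocus S

theorem isAlgebraicSet_empty : IsAlgebraicSet (∅ : Set (ℙ K V)) := by
  refine ⟨{1}, ?_, ?_⟩
  · rintro F rfl
    exact ⟨0, MvPolynomial.isHomogeneous_one _ _⟩
  · ext x
    simp [zeroLocus, evalAt]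

theorem isAlgebraicSet_sInter (A : Set (Set (ℙ K V))) (hA : ∀ Z ∈ A, IsAlgebraicSet Z) :
    IsAlgebraicSet (⋂₀ A) := by
  choose! S hS hZ using hA
  refine ⟨⋃ Z ∈ A, S Z, ?_, ?_⟩
  · intro F hF
    simp only [Set.mem_iUnion] at hF
    obtain ⟨Z, hZA, hF⟩ := hF
    exact hS Z hZA F hF
  · ext x
    constructor
    · intro hx F hF
      simp only [Set.mem_iUnion] at hF
      obtain ⟨Z, hZA, hF⟩ := hF
      have := hx Z hZA
      rw [hZ Z hZA] at this
      exact this F hF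
    · intro hx Z hZA
      rw [hZ Z hZA]
      intro F hF
      exact hx F (Set.mem_biUnion hZA hF)

theorem isAlgebraicSet_union (A B : Set (ℙ K V)) (hA : IsAlgebraicSet A)
    (hB : IsAlgebraicSet B) : IsAlgebraicSet (A ∪ B) := by
  obtain ⟨S, hS, rfl⟩ := hA
  obtain ⟨T, hT, rfl⟩ := hB
  refine ⟨{H | ∃ F ∈ S, ∃ G ∈ T, H = F * G}, ?_, ?_⟩
  · rintro H ⟨F, hF, G, hG, rfl⟩
    obtain ⟨m, hm⟩ := hS F hF
    obtain ⟨n, hn⟩ := hT G hG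
    exact ⟨m + n, hm.mul hn⟩
  · ext x
    constructor
    · rintro (hx | hx) H ⟨F, hF, G, hG, rfl⟩
      · have h0 : evalAt x.rep F = 0 := hx F hF
        simp only [evalAt, map_mul] at h0 ⊢
        rw [h0, zero_mul]
      · have h0 : evalAt x.rep G = 0 := hx G hG
        simp only [evalAt, map_mul] at h0 ⊢
        rw [h0, mul_zero]
    · intro hx
      by_contra hcon
      simp only [Set.mem_union, not_or, zeroLocus, Set.mem_ofPred_eq, not_forall] at hcon
      obtain ⟨⟨F, hF, hF0⟩, ⟨G, hG, hG0⟩⟩ := hcon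
      have h0 : evalAt x.rep (F * G) = 0 := hx (F * G) ⟨F, hF, G, hG, rfl⟩
      simp only [evalAt, map_mul] at h0 hF0 hG0
      exact (mul_ne_zero hF0 hG0) h0

/-- The Zariski topology on the projective space `ℙ K V`: the closed sets are the common zero
loci of homogeneous polynomials on `V`. -/
instance zariskiTopology : TopologicalSpace (ℙ K V) :=
  TopologicalSpace.ofClosed {Z | IsAlgebraicSet Z} isAlgebraicSet_empty
    (fun A hA => isAlgebraicSet_sInter A hA)
    (fun A hA B hB => isAlgebraicSet_union A B hA hB)

end Zariski

/-- The codimension of a closed subset `Z` of a topological space `X`. For an irreducible closed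
`Y` it is the supremum of the lengths of the chains `Y = Y₀ ⊂ Y₁ ⊂ ⋯ ⊂ Yₙ` of irreducible closed
subsets of `X` (the coheight of `Y`); for a closed `Z` it is the infimum of the codimensions of the
irreducible closed subsets of `Z` (so it is infinite for the empty set). -/
def codim {X : Type*} [TopologicalSpace X] (Z : Set X) : ℕ∞ :=
  ⨅ (Y : TopologicalSpace.IrreducibleCloseds X) (_ : (Y : Set X) ⊆ Z), Order.coheight Y

/-! ### Hypersurfaces and their singularities -/

/-- The complex projective space of dimension `M`, with `M + 1` homogeneous coordinates. -/
abbrev ProjSpace (M : ℕ) : Type := ℙ ℂ (Fin (M + 1) → ℂ)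

/-- The projective space of hypersurfaces of degree `d` in the complex projective space of
dimension `M`, that is, of nonzero homogeneous polynomials of degree `d` in `M + 1` variables up to
a scalar factor. -/
abbrev Hypersurfaces (M d : ℕ) : Type :=
  ℙ ℂ (MvPolynomial.homogeneousSubmodule (Fin (M + 1)) ℂ d)

variable {M d : ℕ}

/-- A homogeneous equation of the hypersurface `W` (unique up to a nonzero scalar factor). -/
def equation (W : Hypersurfaces M d) : MvPolynomial (Fin (M + 1)) ℂ :=
  (W.rep : MvPolynomial (Fin (M + 1)) ℂ)

/-- The singular points of the hypersurface `W`: the points of `W` at which all partial derivatives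
of the equation vanish. -/
def singularPoints (W : Hypersurfaces M d) : Set (ProjSpace M) :=
  {p | MvPolynomial.eval p.rep (equation W) = 0 ∧
    ∀ i, MvPolynomial.eval p.rep (MvPolynomial.pderiv i (equation W)) = 0}

/-- The equation of the hypersurface `W` in the affine chart where the `i`-th homogeneous
coordinate is equal to `1`, in the `M` affine coordinates shifted so that the point `p` becomes the
origin. It is only meaningful if the `i`-th homogeneous coordinate of `p` is nonzero. -/
def localEquation (W : Hypersurfaces M d) (p : ProjSpace M) (i : Fin (M + 1)) :
    MvPolynomial (Fin M) ℂ :=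
  MvPolynomial.aeval
    (i.insertNth (α := fun _ => MvPolynomial (Fin M) ℂ) 1
      (fun j => MvPolynomial.X j + MvPolynomial.C (p.rep (i.succAbove j) / p.rep i)))
    (equation W)

/-- The rank of a quadratic form `q` (a homogeneous polynomial of degree `2`): the rank of the
symmetric matrix of its second partial derivatives, which is twice its Gram matrix. -/
def quadraticRank (q : MvPolynomial (Fin M) ℂ) : ℕ :=
  (Matrix.of fun j k : Fin M =>
    MvPolynomial.coeff 0 (MvPolynomial.pderiv j (MvPolynomial.pderiv k q))).rank

/-- The point `p` is a quadratic singularity of rank `r` of the hypersurface `W`: in an affine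
chart centred at `p` the equation of `W` is `q₂ + q₃ + ⋯`, where `qₖ` is homogeneous of degree `k`
and `q₂` is a nonzero quadratic form of rank `r`. (This does not depend on the chart.) -/
def IsQuadraticSingularity (W : Hypersurfaces M d) (p : ProjSpace M) (r : ℕ) : Prop :=
  ∃ i : Fin (M + 1), p.rep i ≠ 0 ∧
    MvPolynomial.homogeneousComponent 0 (localEquation W p i) = 0 ∧
    MvPolynomial.homogeneousComponent 1 (localEquation W p i) = 0 ∧
    MvPolynomial.homogeneousComponent 2 (localEquation W p i) ≠ 0 ∧
    quadraticRank (MvPolynomial.homogeneousComponent 2 (localEquation W p i)) = r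

end FanoDouble

end

/-!
Write `M = n + 2`. The complement of `Wreg` is the closure of the union of finitely many loci, and
each locus has the following form: there are linear functionals on the space of forms, depending
polynomially on some parameters, which for some value of the parameters are linearly independent and
all vanish on the equation of the hypersurface. By Cramer's rule such a locus is covered by finitely
many images of polynomial maps, so that its codimension is at least the number of functionals minus
the number of parameters (`le_codim_of_linearConditions`).

The bound on the codimension in the sense of chains of irreducible closed sets is elementary
(`le_coheight_of_subset_closure_projImage`). Let `Y` be an irreducible closed set in the closure of
the image of a polynomial map with fewer parameters than there are coordinates. The coordinates of
the map are algebraically dependent, so some point is not in `Y`. A cone over `Y` through this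
point is irreducible, its closure properly contains `Y`, and it lies in the closure of the image of
a map with just one more parameter; now iterate.

*Singular points of small rank.* At a singular point `p` that is not a quadratic singularity of rank
at least `3` the Hessian in an affine chart has `n` independent vectors in its kernel. In reduced
echelon form these depend on `2 * n` parameters, and `p` on `n + 2` parameters. The conditions are
the `n + 3` derivatives at `p` and the values of the Hessian on pairs of vectors of a basis
extending the given ones, of which at least one is given: `n * (n + 1) / 2 + 2 * n` of them. The
difference is `n * (n + 1) / 2 + 1` (`le_codim_smallRankLocus`, `exists_mem_smallRankLocus`).

*Infinitely many singular points.* Among the linear subspaces with infinitely many singular points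
take one of the smallest dimension `k ≥ 1`. Every proper subspace of it has only finitely many
singular points, so arbitrarily many of them can be chosen in linear general position
(`exists_finset_general_position`). Take `k * (n + 1) + 1` of them. As the degree is
`2 * (n + 1) + 2`, they impose independent conditions: all but one of the points lie on `n + 1`
hyperplanes not containing the last one, and the squares of the equations of these hyperplanes
times quadratic forms separate the gradients at the last point (`linearIndependent_gradForm`). The
first `k + 1` points, a basis of the subspace, depend on as many parameters as they impose
conditions; each of the other `k * n` points depends on `k` parameters and imposes `n + 3`
conditions, which is enough (`le_codim_manyDoublePointsLocus`,
`exists_mem_manyDoublePointsLocus`).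
-/

noncomputable section

namespace FanoDouble

/-! ### Irreducible closed subsets of a projective space and their codimension -/

section Dimension

theorem eval_smul_of_isHomogeneous {R τ : Type*} [CommSemiring R] {n : ℕ} {F : MvPolynomial τ R}
    (hF : F.IsHomogeneous n) (c : R) (x : τ → R) :
    MvPolynomial.eval (c • x) F = c ^ n * MvPolynomial.eval x F := by
  rw [MvPolynomial.eval_eq, MvPolynomial.eval_eq, Finset.mul_sum]
  refine Finset.sum_congr rfl fun m hm => ?_
  have hdeg := hF.degree_eq_sum_deg_support hm
  simp only [Pi.smul_apply, smul_eq_mul, mul_pow, Finset.prod_mul_distrib,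
    Finset.prod_pow_eq_pow_sum]
  rw [← hdeg]
  ring

theorem eval_smul_eq_eval_polynomial {K τ : Type*} [Field K] (G : MvPolynomial τ K) (x : τ → K)
    (c : K) : MvPolynomial.eval (c • x) G = (∑ i ∈ Finset.range (G.totalDegree + 1),
      Polynomial.C (MvPolynomial.eval x (MvPolynomial.homogeneousComponent i G)) *
        Polynomial.X ^ i).eval c := by
  conv_lhs => rw [← MvPolynomial.sum_homogeneousComponent G]
  rw [map_sum, Polynomial.eval_finsetSum]
  refine Finset.sum_congr rfl fun i _ => ?_
  rw [eval_smul_of_isHomogeneous (MvPolynomial.homogeneousComponent_isHomogeneous i G)]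
  rw [Polynomial.eval_C_mul, Polynomial.eval_pow, Polynomial.eval_X, mul_comm]

/-- A polynomial vanishes on a punctured line through the origin if and only if its homogeneous
components vanish on this line. -/
theorem forall_eval_smul_eq_zero_iff {K τ : Type*} [Field K] [Infinite K]
    (G : MvPolynomial τ K) (x : τ → K) :
    (∀ c : K, c ≠ 0 → MvPolynomial.eval (c • x) G = 0) ↔
      ∀ i, MvPolynomial.eval x (MvPolynomial.homogeneousComponent i G) = 0 := by
  constructor
  · intro h i
    by_cases hi : i ∈ Finset.range (G.totalDegree + 1)
    · have h0 : (∑ i ∈ Finset.range (G.totalDegree + 1),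
          Polynomial.C (MvPolynomial.eval x (MvPolynomial.homogeneousComponent i G)) *
            Polynomial.X ^ i) = 0 := by
        refine Polynomial.eq_zero_of_infinite_isRoot _
          (((Set.finite_singleton (0 : K)).infinite_compl).mono fun c hc => ?_)
        rw [Set.mem_ofPred_eq, Polynomial.IsRoot.def, ← eval_smul_eq_eval_polynomial]
        exact h c hc
      have := congrArg (fun p => Polynomial.coeff p i) h0
      simp only [Polynomial.finsetSum_coeff, Polynomial.coeff_C_mul,
        Polynomial.coeff_X_pow, mul_ite, mul_one, mul_zero, Polynomial.coeff_zero] at this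
      rwa [Finset.sum_ite_eq, if_pos hi] at this
    · rw [MvPolynomial.homogeneousComponent_eq_zero]
      · simp
      · simpa using hi
  · intro h c _
    rw [eval_smul_eq_eval_polynomial]
    rw [Finset.sum_eq_zero fun i _ => by rw [h, Polynomial.C_0, zero_mul], Polynomial.eval_zero]

variable {K V : Type*} [Field K] [AddCommGroup V] [Module K V]

theorem evalAt_smul {n : ℕ} {F : MvPolynomial (Module.Dual K V) K} (hF : F.IsHomogeneous n)
    (c : K) (v : V) : evalAt (c • v) F = c ^ n * evalAt v F := by
  rw [evalAt, evalAt, ← eval_smul_of_isHomogeneous hF]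
  congr 2
  ext φ
  simp

theorem evalAt_rep_mk {n : ℕ} {F : MvPolynomial (Module.Dual K V) K} (hF : F.IsHomogeneous n)
    {v : V} (hv : v ≠ 0) : evalAt (Projectivization.mk K v hv).rep F = 0 ↔ evalAt v F = 0 := by
  obtain ⟨a, ha⟩ := Projectivization.exists_smul_eq_mk_rep K v hv
  rw [← ha, Units.smul_def, evalAt_smul hF]
  simp

theorem isClosed_iff_isAlgebraicSet {Z : Set (ℙ K V)} : IsClosed Z ↔ IsAlgebraicSet Z := by
  rw [← isOpen_compl_iff]
  change Zᶜᶜ ∈ {Z | IsAlgebraicSet Z} ↔ _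
  simp

theorem isClosed_zeroLocus {S : Set (MvPolynomial (Module.Dual K V) K)}
    (hS : ∀ F ∈ S, ∃ n : ℕ, F.IsHomogeneous n) : IsClosed (zeroLocus S) :=
  isClosed_iff_isAlgebraicSet.2 ⟨S, hS, rfl⟩

/-- The restriction of a polynomial function to the line through `u` with direction `e`. -/
def onLine (u e : V) (F : MvPolynomial (Module.Dual K V) K) : Polynomial K :=
  MvPolynomial.aeval
    (fun φ : Module.Dual K V => Polynomial.C (φ u) + Polynomial.X * Polynomial.C (φ e)) F

theorem eval_onLine (u e : V) (F : MvPolynomial (Module.Dual K V) K) (t : K) :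
    (onLine u e F).eval t = evalAt (u + t • e) F := by
  rw [onLine, evalAt, ← Polynomial.coe_evalRingHom, MvPolynomial.aeval_def, MvPolynomial.hom_eval₂,
    ← MvPolynomial.eval₂_id]
  congr 1
  · exact RingHom.ext fun x => Polynomial.eval_C
  · ext φ
    simp
    ring

variable [Infinite K]

/-- The condition that an arbitrary polynomial function vanishes on the punctured line over a point
is closed: it means that all its homogeneous components vanish at the point. -/
theorem isClosed_forall_evalAt_smul (G : MvPolynomial (Module.Dual K V) K) :
    IsClosed {x : ℙ K V | ∀ c : K, c ≠ 0 → evalAt (c • x.rep) G = 0} := by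
  convert isClosed_zeroLocus (K := K) (V := V)
    (S := Set.range fun i : ℕ => MvPolynomial.homogeneousComponent i G) ?_ using 1
  · ext x
    simp only [Set.mem_ofPred_eq, zeroLocus, Set.forall_mem_range]
    have hsmul : ∀ c : K, evalAt (c • x.rep) G =
        MvPolynomial.eval (c • fun φ : Module.Dual K V => φ x.rep) G := by
      intro c
      rw [evalAt]
      congr 2
      ext φ
      simp
    simp only [hsmul]
    exact forall_eval_smul_eq_zero_iff G fun φ : Module.Dual K V => φ x.rep
  · rintro _ ⟨i, rfl⟩
    exact ⟨i, MvPolynomial.homogeneousComponent_isHomogeneous i G⟩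

/-- The points of a projective space such that the line joining them to the point `e` lies in a
given closed set form a closed set. -/
theorem isClosed_forall_line {S : Set (MvPolynomial (Module.Dual K V) K)}
    (hS : ∀ F ∈ S, ∃ n : ℕ, F.IsHomogeneous n) (e : V) :
    IsClosed {x : ℙ K V | ∀ F ∈ S, ∀ t : K, evalAt (x.rep + t • e) F = 0} := by
  have : {x : ℙ K V | ∀ F ∈ S, ∀ t : K, evalAt (x.rep + t • e) F = 0} =
      ⋂ F ∈ S, ⋂ t : K, {x : ℙ K V | ∀ c : K, c ≠ 0 →
        evalAt (c • x.rep) (MvPolynomial.aeval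
          (fun φ : Module.Dual K V => MvPolynomial.X φ + MvPolynomial.C (φ (t • e))) F) = 0} := by
    have key : ∀ (F : MvPolynomial (Module.Dual K V) K) (v w : V),
        evalAt v (MvPolynomial.aeval
          (fun φ : Module.Dual K V => MvPolynomial.X φ + MvPolynomial.C (φ w)) F) =
          evalAt (v + w) F := by
      intro F v w
      rw [evalAt, evalAt, MvPolynomial.aeval_def, MvPolynomial.hom_eval₂, ← MvPolynomial.eval₂_id]
      congr 1
      · ext; simp
      · ext φ
        simp
    ext x
    simp only [Set.mem_iInter, Set.mem_ofPred_eq, key]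
    refine forall₂_congr fun F hF => ?_
    obtain ⟨n, hn⟩ := hS F hF
    constructor
    · intro h t c hc
      have : c • x.rep + t • e = c • (x.rep + (c⁻¹ * t) • e) := by
        rw [smul_add, smul_smul, mul_inv_cancel_left₀ hc]
      rw [this, evalAt_smul hn, h, mul_zero]
    · intro h t
      simpa using h t 1 one_ne_zero
  rw [this]
  exact isClosed_biInter fun F _ => isClosed_iInter fun t => isClosed_forall_evalAt_smul _

/-- A polynomial function vanishing at the nonzero vectors of a line vanishes on the line. -/
theorem evalAt_line_eq_zero {F : MvPolynomial (Module.Dual K V) K}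
    (u : V) {e : V} (he : e ≠ 0)
    (h : ∀ t : K, u + t • e ≠ 0 → evalAt (u + t • e) F = 0) (t : K) :
    evalAt (u + t • e) F = 0 := by
  have hfin : {t : K | u + t • e = 0}.Finite := by
    refine Set.Subsingleton.finite fun s hs t ht => ?_
    have : (s - t) • e = 0 := by
      rw [sub_smul, sub_eq_zero]
      exact add_left_cancel (Eq.trans (b := (0 : V)) hs (Eq.symm ht))
    exact sub_eq_zero.1 ((smul_eq_zero.1 this).resolve_right he)
  have h0 : onLine u e F = 0 := by
    refine Polynomial.eq_zero_of_infinite_isRoot _ (hfin.infinite_compl.mono fun t ht => ?_)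
    rw [Set.mem_ofPred_eq, Polynomial.IsRoot.def, eval_onLine]
    exact h t ht
  rw [← eval_onLine, h0, Polynomial.eval_zero]

/-- The cone over `Y` with vertex `e`: the union of the lines joining the points of `Y` to the
point `e` (of which the vertex itself may be missing). -/
def coneOver (Y : Set (ℙ K V)) (e : V) : Set (ℙ K V) :=
  {x | ∃ y ∈ Y, ∃ (t : K) (h : y.rep + t • e ≠ 0), x = Projectivization.mk K (y.rep + t • e) h}

omit [Infinite K] in
theorem subset_coneOver (Y : Set (ℙ K V)) (e : V) : Y ⊆ coneOver Y e := by
  intro y hy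
  refine ⟨y, hy, 0, by simpa using y.rep_nonzero, ?_⟩
  simp only [zero_smul, add_zero, Projectivization.mk_rep]

/-- A line is irreducible, so if two closed sets cover the cone, each line of the cone is in one of
them; by `isClosed_forall_line`, one of the two closed sets contains all these lines. -/
theorem isIrreducible_coneOver {Y : Set (ℙ K V)} (hY : IsIrreducible Y) {e : V} (he : e ≠ 0) :
    IsIrreducible (coneOver Y e) := by
  refine ⟨hY.1.mono (subset_coneOver Y e), ?_⟩
  rw [isPreirreducible_iff_isClosed_union_isClosed]
  intro Z₁ Z₂ hZ₁ hZ₂ hsub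
  obtain ⟨S₁, hS₁, rfl⟩ := isClosed_iff_isAlgebraicSet.1 hZ₁
  obtain ⟨S₂, hS₂, rfl⟩ := isClosed_iff_isAlgebraicSet.1 hZ₂
  have hcone : ∀ S : Set (MvPolynomial (Module.Dual K V) K),
      (∀ F ∈ S, ∃ n : ℕ, F.IsHomogeneous n) →
      Y ⊆ {x : ℙ K V | ∀ F ∈ S, ∀ t : K, evalAt (x.rep + t • e) F = 0} →
      coneOver Y e ⊆ zeroLocus S := by
    rintro S hS h _ ⟨y, hy, t, hne, rfl⟩ F hF
    obtain ⟨n, hn⟩ := hS F hF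
    rw [evalAt_rep_mk hn]
    exact h hy F hF t
  refine (isPreirreducible_iff_isClosed_union_isClosed.1 hY.2 _ _ (isClosed_forall_line hS₁ e)
    (isClosed_forall_line hS₂ e) ?_).imp (hcone S₁ hS₁) (hcone S₂ hS₂)
  intro y hy
  by_contra hcon
  simp only [Set.mem_union, not_or, Set.mem_ofPred_eq, not_forall] at hcon
  obtain ⟨⟨F, hF, t₁, h₁⟩, ⟨G, hG, t₂, h₂⟩⟩ := hcon
  obtain ⟨m, hm⟩ := hS₁ F hF
  obtain ⟨n, hn⟩ := hS₂ G hG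
  have hFG : ∀ t : K, evalAt (y.rep + t • e) (F * G) = 0 := by
    refine evalAt_line_eq_zero y.rep he fun t ht => ?_
    rw [evalAt, map_mul, ← evalAt, ← evalAt]
    rcases hsub ⟨y, hy, t, ht, rfl⟩ with h | h
    · rw [(evalAt_rep_mk hm ht).1 (h F hF), zero_mul]
    · rw [(evalAt_rep_mk hn ht).1 (h G hG), mul_zero]
  have h0 : onLine y.rep e F * onLine y.rep e G = 0 := by
    refine Polynomial.funext fun t => ?_
    have := hFG t
    rw [evalAt, map_mul, ← evalAt, ← evalAt] at this
    rw [Polynomial.eval_mul, eval_onLine, eval_onLine, this, Polynomial.eval_zero]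
  rcases mul_eq_zero.1 h0 with h | h
  · exact h₁ (by rw [← eval_onLine, h, Polynomial.eval_zero])
  · exact h₂ (by rw [← eval_onLine, h, Polynomial.eval_zero])

/-! ### Polynomial parametrizations -/

variable (K) in
/-- The algebra of polynomial functions on the affine space `σ → K`. -/
def polyFun (σ : Type*) : Subalgebra K ((σ → K) → K) :=
  (MvPolynomial.aeval fun (i : σ) (a : σ → K) => a i :
    MvPolynomial σ K →ₐ[K] ((σ → K) → K)).range

omit [Infinite K] in
theorem mem_polyFun {σ : Type*} {f : (σ → K) → K} :
    f ∈ polyFun K σ ↔ ∃ P : MvPolynomial σ K, ∀ a, f a = MvPolynomial.eval a P := by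
  have key : ∀ (P : MvPolynomial σ K) (a : σ → K),
      (MvPolynomial.aeval (fun (i : σ) (a : σ → K) => a i) P : (σ → K) → K) a =
        MvPolynomial.eval a P := by
    intro P a
    induction P using MvPolynomial.induction_on with
    | C c => simp
    | add p q hp hq => simp [hp, hq]
    | mul_X p i hp => simp [hp]
  rw [polyFun, AlgHom.mem_range]
  constructor
  · rintro ⟨P, rfl⟩
    exact ⟨P, key P⟩
  · rintro ⟨P, hP⟩
    exact ⟨P, funext fun a => (key P a).trans (hP a).symm⟩

omit [Infinite K] in
theorem const_mem_polyFun {σ : Type*} (c : K) : (fun _ => c) ∈ polyFun K σ :=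
  mem_polyFun.2 ⟨MvPolynomial.C c, by simp⟩

omit [Infinite K] in
theorem coord_mem_polyFun {σ : Type*} (i : σ) : (fun a => a i) ∈ polyFun K σ :=
  mem_polyFun.2 ⟨MvPolynomial.X i, by simp⟩

omit [Infinite K] in
theorem eval_comp_mem_polyFun {σ τ : Type*} {p : τ → (σ → K) → K} (hp : ∀ i, p i ∈ polyFun K σ)
    (G : MvPolynomial τ K) : (fun a => MvPolynomial.eval (fun i => p i a) G) ∈ polyFun K σ := by
  choose P hP using fun i => mem_polyFun.1 (hp i)
  refine mem_polyFun.2 ⟨MvPolynomial.aeval P G, fun a => ?_⟩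
  rw [MvPolynomial.aeval_def, MvPolynomial.hom_eval₂, ← MvPolynomial.eval₂_id]
  congr 1
  · ext; simp
  · ext i
    simp [hP]

omit [Infinite K] in
theorem comp_mem_polyFun {σ τ : Type*} {f : (τ → K) → K} (hf : f ∈ polyFun K τ) (s : τ → σ) :
    (fun a : σ → K => f (a ∘ s)) ∈ polyFun K σ := by
  obtain ⟨P, hP⟩ := mem_polyFun.1 hf
  convert eval_comp_mem_polyFun (fun i => coord_mem_polyFun (K := K) (s i)) P using 2 with a
  exact hP _

/-- A polynomial map whose image is a cone is not dominant if it has fewer parameters than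
coordinates: its coordinates are algebraically dependent. -/
theorem exists_form_of_card_lt [FiniteDimensional K V] {σ : Type*} [Fintype σ]
    {φ : (σ → K) → V} (hφ : ∀ l : Module.Dual K V, (fun a => l (φ a)) ∈ polyFun K σ)
    (hcone : ∀ a (c : K), ∃ a', φ a' = c • φ a) (hcard : Fintype.card σ < Module.finrank K V) :
    ∃ (n : ℕ) (F : MvPolynomial (Module.Dual K V) K) (v : V), F.IsHomogeneous n ∧
      (∀ a, evalAt (φ a) F = 0) ∧ v ≠ 0 ∧ evalAt v F ≠ 0 := by
  let b := Module.finBasis K V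
  choose P hP using fun i => mem_polyFun.1 (hφ (b.coord i))
  have hdep : ¬ AlgebraicIndependent K P := by
    intro h
    have h1 := h.lift_cardinalMk_le_trdeg
    rw [MvPolynomial.trdeg_of_isDomain] at h1
    simp only [Cardinal.mk_fintype, Fintype.card_fin, Cardinal.lift_natCast, Nat.cast_le] at h1
    omega
  rw [algebraicIndependent_iff] at hdep
  push Not at hdep
  obtain ⟨G, hG, hG0⟩ := hdep
  have hGv : ∀ a, MvPolynomial.eval (fun i => b.coord i (φ a)) G = 0 := by
    intro a
    have := congrArg (MvPolynomial.eval a) hG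
    rw [MvPolynomial.aeval_def, MvPolynomial.hom_eval₂, map_zero] at this
    rw [← this, ← MvPolynomial.eval₂_id]
    congr 1
    · ext; simp
    · ext i
      simp [hP]
  -- Since the image is a cone, every homogeneous component of `G` vanishes on it.
  have hcomp : ∀ n a, MvPolynomial.eval (fun i => b.coord i (φ a))
      (MvPolynomial.homogeneousComponent n G) = 0 := by
    intro n a
    refine (forall_eval_smul_eq_zero_iff G _).1 (fun c _ => ?_) n
    obtain ⟨a', ha'⟩ := hcone a c
    rw [← hGv a', ha']
    congr 2
    ext i
    simp
  obtain ⟨n, hn⟩ : ∃ n, MvPolynomial.homogeneousComponent n G ≠ 0 := by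
    by_contra! h
    apply hG0
    rw [← MvPolynomial.sum_homogeneousComponent G]
    exact Finset.sum_eq_zero fun i _ => h i
  set H := MvPolynomial.homogeneousComponent n G with hH
  have hHh : H.IsHomogeneous n := MvPolynomial.homogeneousComponent_isHomogeneous n G
  have hren : ∀ v, evalAt v (MvPolynomial.rename (fun i => b.coord i) H) =
      MvPolynomial.eval (fun i => b.coord i v) H := by
    intro v
    rw [evalAt, MvPolynomial.eval_rename]
    rfl
  obtain ⟨r, hr⟩ : ∃ r, MvPolynomial.eval r H ≠ 0 := by
    by_contra! h
    exact hn (MvPolynomial.funext fun r => by simpa using h r)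
  refine ⟨n, MvPolynomial.rename (fun i => b.coord i) H, b.equivFun.symm r,
    hHh.rename_isHomogeneous, fun a => ?_, ?_, ?_⟩
  · rw [hren, hcomp]
  · -- At the zero vector, which is in the image because the image is a cone, `H` vanishes.
    intro h0
    have hr0 : r = 0 := b.equivFun.symm.map_eq_zero_iff.1 h0
    obtain ⟨a', ha'⟩ := hcone 0 0
    have := hcomp n a'
    rw [ha'] at this
    apply hr
    rw [hr0]
    simpa [Pi.zero_def] using this
  · rw [hren]
    have : (fun i => b.coord i (b.equivFun.symm r)) = r := by
      ext i
      rw [Module.Basis.coord_apply, Module.Basis.equivFun_symm_apply, b.repr_sum_self]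
    rwa [this]

/-- The image in a projective space of a map to the vector space. -/
def projImage {α : Type*} (φ : α → V) : Set (ℙ K V) :=
  {x | ∃ (a : α) (h : φ a ≠ 0), x = Projectivization.mk K (φ a) h}

/-- An irreducible closed set in the closure of the image of a polynomial map has codimension at
least the number of coordinates minus the number of parameters. If the difference is positive, the
image is not dense, and the set is properly contained in a cone over it, which lies in the closure
of the image of a map with one more parameter. -/
theorem le_coheight_of_subset_closure_projImage [FiniteDimensional K V] (c : ℕ) :
    ∀ {σ : Type} [Fintype σ] (φ : (σ → K) → V)
      (_ : ∀ l : Module.Dual K V, (fun a => l (φ a)) ∈ polyFun K σ)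
      (_ : ∀ a (c : K), ∃ a', φ a' = c • φ a) (Y : TopologicalSpace.IrreducibleCloseds (ℙ K V))
      (_ : (Y : Set (ℙ K V)) ⊆ closure (projImage φ))
      (_ : c + Fintype.card σ ≤ Module.finrank K V), (c : ℕ∞) ≤ Order.coheight Y := by
  induction c with
  | zero => intros; simp
  | succ c ih =>
    intro σ _ φ hφ hcone Y hdom hcard
    obtain ⟨n, F, v, hF, hFφ, hv, hFv⟩ := exists_form_of_card_lt hφ hcone (by omega)
    have hvY : Projectivization.mk K v hv ∉ (Y : Set (ℙ K V)) := by
      intro h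
      have hcl : IsClosed {x : ℙ K V | evalAt x.rep F = 0} := by
        convert isClosed_zeroLocus (K := K) (V := V) (S := {F}) (by rintro _ rfl; exact ⟨n, hF⟩)
        simp [zeroLocus]
      refine hFv ((evalAt_rep_mk hF hv).1 (closure_minimal ?_ hcl (hdom h)))
      rintro _ ⟨a, ha, rfl⟩
      exact (evalAt_rep_mk hF ha).2 (hFφ a)
    obtain ⟨y, hy⟩ := Y.isIrreducible'.nonempty
    have he : v - y.rep ≠ 0 := by
      intro h
      apply hvY
      have hvy : v = y.rep := sub_eq_zero.1 h
      subst hvy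
      rw [Projectivization.mk_rep]
      exact hy
    set e := v - y.rep with he'
    let Y' : TopologicalSpace.IrreducibleCloseds (ℙ K V) :=
      ⟨closure (coneOver (Y : Set (ℙ K V)) e), (isIrreducible_coneOver Y.isIrreducible' he).closure,
        isClosed_closure⟩
    have hlt : Y < Y' := by
      refine lt_of_le_of_ne
        (fun x hx => subset_closure (subset_coneOver (Y : Set (ℙ K V)) e hx)) ?_
      intro h
      apply hvY
      rw [h]
      refine subset_closure ⟨y, hy, 1, by simpa [he'] using hv, ?_⟩
      simp [he']
    have hY' : (c : ℕ∞) ≤ Order.coheight Y' := by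
      refine ih (σ := Option σ) (fun a => φ (fun s => a (some s)) + a none • e) ?_ ?_ Y' ?_ ?_
      · intro l
        have h1 := comp_mem_polyFun (hφ l) (some : σ → Option σ)
        have h2 := mul_mem (coord_mem_polyFun (K := K) (none : Option σ))
          (const_mem_polyFun (σ := Option σ) (l e))
        convert add_mem h1 h2 using 1
        ext a
        simp [Function.comp_def]
      · intro a c
        obtain ⟨a', ha'⟩ := hcone (fun s => a (some s)) c
        refine ⟨fun o => o.elim (c * a none) a', ?_⟩
        simp [ha', mul_smul]
      · refine closure_minimal ?_ isClosed_closure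
        set Z : Set (ℙ K V) := closure (projImage fun a : Option σ → K =>
          φ (fun s => a (some s)) + a none • e)
        have hZc : IsClosed Z := isClosed_closure
        obtain ⟨S, hS, hZS⟩ := isClosed_iff_isAlgebraicSet.1 hZc
        have hsub := hdom.trans (closure_minimal ?_ (isClosed_forall_line hS e))
        · rintro _ ⟨z, hz, t, hne, rfl⟩
          rw [hZS]
          intro G hG
          obtain ⟨m, hm⟩ := hS G hG
          rw [evalAt_rep_mk hm]
          exact hsub hz G hG t
        · rintro _ ⟨a, ha, rfl⟩ G hG
          obtain ⟨m, hm⟩ := hS G hG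
          obtain ⟨u, hu⟩ := Projectivization.exists_smul_eq_mk_rep K (φ a) ha
          obtain ⟨a', ha'⟩ := hcone a u
          rw [← hu, Units.smul_def, ← ha']
          refine evalAt_line_eq_zero _ he fun t ht => ?_
          rw [← evalAt_rep_mk hm ht]
          have hmem : Projectivization.mk K _ ht ∈ Z :=
            subset_closure ⟨fun o => o.elim t a', ht, rfl⟩
          rw [hZS] at hmem
          exact hmem G hG
      · rw [Fintype.card_option]
        omega
    calc ((c + 1 : ℕ) : ℕ∞) = c + 1 := by push_cast; rfl
      _ ≤ Order.coheight Y' + 1 := by gcongr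
      _ ≤ Order.coheight Y := Order.coheight_add_one_le hlt

/-- The codimension of the closure of a finite union is bounded from below by a common bound for
the codimensions of the closures of its members. -/
theorem le_codim_closure_iUnion {X ι : Type*} [TopologicalSpace X] [Finite ι] (B : ι → Set X)
    (c : ℕ∞) (h : ∀ i, c ≤ codim (closure (B i))) : c ≤ codim (closure (⋃ i, B i)) := by
  rw [closure_iUnion_of_finite]
  refine le_iInf₂ fun Y hY => ?_
  have : ∃ i, (Y : Set X) ⊆ closure (B i) := by
    have := (isIrreducible_iff_sUnion_isClosed.1 Y.isIrreducible')
      (Set.finite_range fun i => closure (B i)).toFinset (by simp)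
      (by rw [Set.Finite.coe_toFinset, Set.sUnion_range]; exact hY)
    simp only [Set.Finite.mem_toFinset, Set.mem_range, exists_exists_eq_and] at this
    exact this
  obtain ⟨i, hi⟩ := this
  exact (h i).trans (iInf₂_le Y hi)

theorem codim_anti {X : Type*} [TopologicalSpace X] {A B : Set X} (h : A ⊆ B) :
    codim B ≤ codim A :=
  le_iInf₂ fun Y hY => iInf₂_le Y (hY.trans h)

end Dimension

/-! ### Families of linear conditions -/

section LinearConditions

theorem exists_submatrix_det_ne_zero {K ρ ι : Type*} [Field K] [Fintype ρ] [DecidableEq ρ]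
    [Fintype ι] (A : Matrix ρ ι K) (h : LinearIndependent K A.row) :
    ∃ e : ρ → ι, (A.submatrix id e).det ≠ 0 := by
  have hr := h.rank_matrix
  rw [Matrix.rank_eq_finrank_span_cols] at hr
  obtain ⟨f, hf, -, hind⟩ := Submodule.exists_fun_fin_finrank_span_eq K (Set.range A.col)
  choose g hg using hf
  let E : ρ ≃ Fin (Module.finrank K (Submodule.span K (Set.range A.col))) :=
    Fintype.equivOfCardEq (by rw [Fintype.card_fin, hr])
  refine ⟨g ∘ E, ?_⟩
  have hcol : (A.submatrix id (g ∘ E)).col = f ∘ E := by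
    ext s r
    exact congrFun (hg (E s)) r
  have := Matrix.linearIndependent_cols_iff_isUnit.1 (hcol ▸ hind.comp E E.injective)
  exact ((Matrix.isUnit_iff_isUnit_det _).1 this).ne_zero

variable {K V : Type*} [Field K] [AddCommGroup V] [Module K V]

theorem det_mem_polyFun {σ ρ : Type*} [Fintype ρ] [DecidableEq ρ] {A : (σ → K) → Matrix ρ ρ K}
    (hA : ∀ r s, (fun a => A a r s) ∈ polyFun K σ) : (fun a => (A a).det) ∈ polyFun K σ := by
  choose P hP using fun r s => mem_polyFun.1 (hA r s)
  refine mem_polyFun.2 ⟨(Matrix.of P).det, fun a => ?_⟩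
  rw [RingHom.map_det]
  congr 1
  ext r s
  exact hP r s a

theorem adjugate_mem_polyFun {σ ρ : Type*} [Fintype ρ] [DecidableEq ρ]
    {A : (σ → K) → Matrix ρ ρ K} (hA : ∀ r s, (fun a => A a r s) ∈ polyFun K σ) (r s : ρ) :
    (fun a => (A a).adjugate r s) ∈ polyFun K σ := by
  choose P hP using fun r s => mem_polyFun.1 (hA r s)
  refine mem_polyFun.2 ⟨(Matrix.of P).adjugate r s, fun a => ?_⟩
  have : A a = (MvPolynomial.eval a).mapMatrix (Matrix.of P) := by
    ext r s
    exact hP r s a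
  rw [this, ← RingHom.map_adjugate]
  rfl

theorem sum_mem_polyFun {σ κ : Type*} (s : Finset κ) {f : κ → (σ → K) → K}
    (hf : ∀ i ∈ s, f i ∈ polyFun K σ) : (fun a => ∑ i ∈ s, f i a) ∈ polyFun K σ := by
  convert sum_mem hf using 1
  ext a
  simp

variable [Infinite K] [FiniteDimensional K V]

/-- Let `L r a` be linear forms on `V` depending polynomially on parameters `a`. The points of
`ℙ K V` at which, for some value of the parameters, these forms are linearly independent and all
vanish form a set of codimension at least the number of conditions minus the number of parameters.
By Cramer's rule, this set is a finite union of images of polynomial maps. -/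
theorem le_codim_of_linearConditions {ρ σ : Type} [Fintype ρ] [Fintype σ]
    (L : ρ → (σ → K) → Module.Dual K V) (hL : ∀ r v, (fun a => L r a v) ∈ polyFun K σ) (c : ℕ)
    (hc : c + Fintype.card σ ≤ Fintype.card ρ) :
    (c : ℕ∞) ≤ codim (closure {x : ℙ K V | ∃ a : σ → K,
      LinearIndependent K (fun r => L r a) ∧ ∀ r, L r a x.rep = 0}) := by
  classical
  let b := Module.finBasis K V
  let ι := Fin (Module.finrank K V)
  let A : (ρ ↪ ι) → (σ → K) → Matrix ρ ρ K := fun e a => Matrix.of fun r s => L r a (b (e s))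
  let B : (ρ ↪ ι) → Set (ℙ K V) := fun e =>
    {x | ∃ a : σ → K, (A e a).det ≠ 0 ∧ ∀ r, L r a x.rep = 0}
  have hsub : {x : ℙ K V | ∃ a : σ → K,
      LinearIndependent K (fun r => L r a) ∧ ∀ r, L r a x.rep = 0} ⊆ ⋃ e, B e := by
    rintro x ⟨a, hind, hx⟩
    have hrow : LinearIndependent K (Matrix.of fun (r : ρ) (i : ι) => L r a (b i)).row := by
      have := hind.map' (b.constr K (M' := K)).symm.toLinearMap (LinearEquiv.ker _)
      exact this
    obtain ⟨e, he⟩ := exists_submatrix_det_ne_zero _ hrow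
    have hinj : Function.Injective e := by
      intro s t hst
      by_contra hne
      exact he (Matrix.det_zero_of_column_eq hne fun r => by simp [hst])
    exact Set.mem_iUnion.2 ⟨⟨e, hinj⟩, a, he, hx⟩
  refine le_trans ?_ (codim_anti (closure_mono hsub))
  refine le_codim_closure_iUnion B c fun e => le_iInf₂ fun Y hY => ?_
  -- `T a` is multiplication by the determinant on the space of solutions, and it kills the pivots.
  let T : (σ → K) → V →ₗ[K] V := fun a => (A e a).det • LinearMap.id -
    ∑ s, ∑ r, (A e a).adjugate s r • (L r a).smulRight (b (e s))
  have hT : ∀ a v, T a v = (A e a).det • v -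
      ∑ s, ∑ r, ((A e a).adjugate s r * L r a v) • b (e s) := by
    intro a v
    simp [T, LinearMap.sum_apply, mul_smul]
  have hTe : ∀ a s, T a (b (e s)) = 0 := by
    intro a s
    rw [hT, sub_eq_zero]
    have : ∀ s', ∑ r, ((A e a).adjugate s' r * L r a (b (e s))) • b (e s') =
        ((A e a).det • (1 : Matrix ρ ρ K)) s' s • b (e s') := by
      intro s'
      rw [← Matrix.adjugate_mul, Matrix.mul_apply, Finset.sum_smul]
      rfl
    simp only [this, Matrix.smul_apply, Matrix.one_apply, smul_eq_mul, mul_ite, mul_one, mul_zero,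
      ite_smul, zero_smul]
    simp
  let φ : (σ ⊕ {i // i ∉ Set.range e} → K) → V := fun x =>
    T (x ∘ Sum.inl) (∑ i, x (Sum.inr i) • b i.1)
  refine le_coheight_of_subset_closure_projImage c φ ?_ ?_ Y (hY.trans (closure_mono ?_)) ?_
  · intro l
    have h1 := det_mem_polyFun (A := A e) fun r s => hL r (b (e s))
    have h2 := fun s r => adjugate_mem_polyFun (A := A e) (fun r s => hL r (b (e s))) s r
    have h3 : ∀ l' : (σ → K) → Module.Dual K V, (∀ v, (fun a => l' a v) ∈ polyFun K σ) →
        (fun x : σ ⊕ {i // i ∉ Set.range e} → K =>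
          l' (x ∘ Sum.inl) (∑ i, x (Sum.inr i) • b i.1)) ∈ polyFun K _ := by
      intro l' hl'
      simp only [map_sum, map_smul, smul_eq_mul]
      exact sum_mem_polyFun _ fun i _ => mul_mem (coord_mem_polyFun (Sum.inr i))
        (comp_mem_polyFun (hl' _) Sum.inl)
    have h4 : ∀ v, (fun a => l (T a v)) ∈ polyFun K σ := by
      intro v
      simp only [hT, map_sub, map_smul, map_sum, smul_eq_mul]
      exact sub_mem (mul_mem h1 (const_mem_polyFun _)) (sum_mem_polyFun _ fun s _ =>
        sum_mem_polyFun _ fun r _ => mul_mem (mul_mem (h2 s r) (hL r v)) (const_mem_polyFun _))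
    exact h3 (fun a => l.comp (T a)) h4
  · intro x c
    refine ⟨Sum.elim (x ∘ Sum.inl) (c • (x ∘ Sum.inr)), ?_⟩
    simp only [φ, Sum.elim_comp_inl, Sum.elim_inr, Pi.smul_apply, smul_assoc, Function.comp_apply]
    rw [← Finset.smul_sum, map_smul]
  · rintro x ⟨a, hdet, hx⟩
    have hker : T a x.rep = (A e a).det • x.rep := by
      rw [hT]
      simp [hx]
    have hsum : T a (∑ i : {i // i ∉ Set.range e}, b.repr x.rep i.1 • b i.1) = T a x.rep := by
      conv_rhs => rw [← b.sum_repr x.rep]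
      rw [map_sum, map_sum, ← Fintype.sum_subtype_add_sum_subtype (fun i => i ∉ Set.range e)]
      refine (add_eq_left.2 (Finset.sum_eq_zero fun i _ => ?_)).symm
      obtain ⟨s, hs⟩ := not_not.1 i.2
      rw [← hs, map_smul, hTe, smul_zero]
    have hφ : φ (Sum.elim a fun i => (A e a).det⁻¹ * b.repr x.rep i.1) = x.rep := by
      simp only [φ, Sum.elim_comp_inl, Sum.elim_inr, mul_smul]
      rw [← Finset.smul_sum, map_smul, hsum, hker, inv_smul_smul₀ hdet]
    refine ⟨_, by rw [hφ]; exact x.rep_nonzero, ?_⟩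
    simp only [hφ, Projectivization.mk_rep]
  · have h1 : Fintype.card {i // i ∉ Set.range e} = Module.finrank K V - Fintype.card ρ := by
      rw [Fintype.card_subtype_compl, Fintype.card_fin]
      congr 1
      exact Set.card_range_of_injective e.injective
    have h2 : Fintype.card ρ ≤ Module.finrank K V := by
      simpa [ι] using Fintype.card_le_of_embedding e
    rw [Fintype.card_sum, h1]
    omega

end LinearConditions

/-! ### Derivatives of forms at a point as linear functionals -/

section Derivatives

variable {τ : Type*} [Fintype τ]

/-- The derivative of polynomials in the direction of the vector `u`. -/
def dirDeriv (u : τ → ℂ) : Derivation ℂ (MvPolynomial τ ℂ) (MvPolynomial τ ℂ) :=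
  ∑ k, u k • MvPolynomial.pderiv k

theorem dirDeriv_apply (u : τ → ℂ) (F : MvPolynomial τ ℂ) :
    dirDeriv u F = ∑ k, u k • MvPolynomial.pderiv k F := by
  have := congrFun (map_sum (Derivation.coeFnAddMonoidHom (R := ℂ) (A := MvPolynomial τ ℂ)
    (M := MvPolynomial τ ℂ)) (fun k => u k • MvPolynomial.pderiv k) Finset.univ) F
  rw [Finset.sum_apply] at this
  exact this

theorem eval_dirDeriv (p u : τ → ℂ) (F : MvPolynomial τ ℂ) :
    MvPolynomial.eval p (dirDeriv u F) =
      ∑ k, u k * MvPolynomial.eval p (MvPolynomial.pderiv k F) := by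
  simp [dirDeriv_apply, MvPolynomial.smul_eval]

theorem eval_dirDeriv_dirDeriv (p u v : τ → ℂ) (F : MvPolynomial τ ℂ) :
    MvPolynomial.eval p (dirDeriv u (dirDeriv v F)) = ∑ k, u k * ∑ l, v l *
      MvPolynomial.eval p (MvPolynomial.pderiv k (MvPolynomial.pderiv l F)) := by
  rw [eval_dirDeriv]
  simp [dirDeriv_apply, MvPolynomial.smul_eval]

theorem dirDeriv_smul_vec (c : ℂ) (u : τ → ℂ) (F : MvPolynomial τ ℂ) :
    dirDeriv (c • u) F = c • dirDeriv u F := by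
  simp [dirDeriv_apply, Finset.smul_sum, mul_smul]

/-- Euler's identity at a point. -/
theorem eval_dirDeriv_self {n : ℕ} {F : MvPolynomial τ ℂ} (hF : F.IsHomogeneous n) (p : τ → ℂ) :
    MvPolynomial.eval p (dirDeriv p F) = n * MvPolynomial.eval p F := by
  have := congrArg (MvPolynomial.eval p) hF.sum_X_mul_pderiv
  simpa [eval_dirDeriv] using this

variable [DecidableEq τ]

/-- The polynomial of degree `1` given by a linear form. -/
def linPoly (m : Module.Dual ℂ (τ → ℂ)) : MvPolynomial τ ℂ :=
  ∑ k, m (Pi.single k 1) • MvPolynomial.X k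

theorem linPoly_isHomogeneous (m : Module.Dual ℂ (τ → ℂ)) : (linPoly m).IsHomogeneous 1 :=
  MvPolynomial.IsHomogeneous.sum _ _ _ fun k _ => by
    rw [MvPolynomial.smul_eq_C_mul]
    exact MvPolynomial.isHomogeneous_C_mul_X _ _

theorem sum_apply_single_mul (m : Module.Dual ℂ (τ → ℂ)) (x : τ → ℂ) :
    ∑ k, m (Pi.single k 1) * x k = m x := by
  conv_rhs => rw [pi_eq_sum_univ' x, map_sum]
  refine Finset.sum_congr rfl fun k _ => ?_
  rw [map_smul, smul_eq_mul, mul_comm]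

@[simp]
theorem eval_linPoly (m : Module.Dual ℂ (τ → ℂ)) (x : τ → ℂ) :
    MvPolynomial.eval x (linPoly m) = m x := by
  simp only [linPoly, map_sum, MvPolynomial.smul_eval, MvPolynomial.eval_X]
  exact sum_apply_single_mul m x

@[simp]
theorem dirDeriv_linPoly (m : Module.Dual ℂ (τ → ℂ)) (u : τ → ℂ) :
    dirDeriv u (linPoly m) = MvPolynomial.C (m u) := by
  rw [linPoly, map_sum, ← sum_apply_single_mul m u, map_sum]
  refine Finset.sum_congr rfl fun k _ => ?_
  rw [Derivation.map_smul, dirDeriv_apply, Finset.sum_eq_single k]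
  · simp [MvPolynomial.smul_eq_C_mul]
  · intro l _ hl
    simp [MvPolynomial.pderiv_X_of_ne hl.symm]
  · simp

/-- The gradient at `p` of a product of a form `G` not vanishing at `p` with a quadratic form
is not confined to a hyperplane. -/
theorem exists_quadric_dirDeriv_ne_zero {e : ℕ} {G : MvPolynomial τ ℂ} (hG : G.IsHomogeneous e)
    {p v : τ → ℂ} (hp : p ≠ 0) (hv : v ≠ 0) (hGp : MvPolynomial.eval p G ≠ 0) :
    ∃ q : MvPolynomial τ ℂ, q.IsHomogeneous 2 ∧
      MvPolynomial.eval p (dirDeriv v (q * G)) ≠ 0 := by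
  obtain ⟨l, hl⟩ : ∃ l : Module.Dual ℂ (τ → ℂ), l p ≠ 0 := by
    by_contra! h
    exact hp ((Module.forall_dual_apply_eq_zero_iff ℂ p).1 h)
  by_cases hvp : v ∈ Submodule.span ℂ {p}
  · obtain ⟨c, rfl⟩ := Submodule.mem_span_singleton.1 hvp
    have hc : c ≠ 0 := by
      rintro rfl
      simp at hv
    refine ⟨linPoly l * linPoly l, (linPoly_isHomogeneous l).mul (linPoly_isHomogeneous l), ?_⟩
    rw [dirDeriv_smul_vec, MvPolynomial.smul_eval, eval_dirDeriv_self
      (((linPoly_isHomogeneous l).mul (linPoly_isHomogeneous l)).mul hG)]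
    simp only [map_mul, eval_linPoly]
    have : ((1 + 1 + e : ℕ) : ℂ) ≠ 0 := Nat.cast_ne_zero.2 (by omega)
    positivity
  · obtain ⟨m, hmv, hmp⟩ := Submodule.exists_le_ker_of_notMem hvp
    have hmp : m p = 0 := hmp (Submodule.mem_span_singleton_self p)
    refine ⟨linPoly m * linPoly l, (linPoly_isHomogeneous m).mul (linPoly_isHomogeneous l), ?_⟩
    simp [hmp, hmv, hl, hGp]

variable (τ) in
/-- The space of forms of degree `d`. -/
abbrev Forms (d : ℕ) : Type _ := MvPolynomial.homogeneousSubmodule τ ℂ d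

omit [DecidableEq τ] in
instance finiteDimensional_forms (d : ℕ) : FiniteDimensional ℂ (Forms τ d) :=
  Module.Finite.iff_fg.2 (MvPolynomial.homogeneousSubmodule_fg τ ℂ d)

/-- The functional taking a form to the value at `p` of its `k`-th partial derivative. -/
def gradForm {d : ℕ} (p : τ → ℂ) (k : τ) : Module.Dual ℂ (Forms τ d) :=
  (MvPolynomial.aeval p).toLinearMap ∘ₗ (MvPolynomial.pderiv k).toLinearMap ∘ₗ
    Submodule.subtype _

/-- The functional taking a form to the value of its Hessian at `p` on a pair of vectors. -/
def hessForm {d : ℕ} (p u v : τ → ℂ) : Module.Dual ℂ (Forms τ d) :=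
  (MvPolynomial.aeval p).toLinearMap ∘ₗ (dirDeriv u).toLinearMap ∘ₗ
    (dirDeriv v).toLinearMap ∘ₗ Submodule.subtype _

omit [Fintype τ] [DecidableEq τ] in
@[simp]
theorem gradForm_apply {d : ℕ} (p : τ → ℂ) (k : τ) (F : Forms τ d) :
    gradForm p k F = MvPolynomial.eval p (MvPolynomial.pderiv k (F : MvPolynomial τ ℂ)) := by
  rw [← MvPolynomial.coe_aeval_eq_eval]
  rfl

omit [DecidableEq τ] in
@[simp]
theorem hessForm_apply {d : ℕ} (p u v : τ → ℂ) (F : Forms τ d) :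
    hessForm p u v F = MvPolynomial.eval p (dirDeriv u (dirDeriv v (F : MvPolynomial τ ℂ))) := by
  rw [← MvPolynomial.coe_aeval_eq_eval]
  rfl

omit [Fintype τ] [DecidableEq τ] in
theorem gradForm_mem_polyFun {d : ℕ} {σ : Type*} {p : (σ → ℂ) → τ → ℂ}
    (hp : ∀ k, (fun a => p a k) ∈ polyFun ℂ σ) (k : τ) (F : Forms τ d) :
    (fun a => gradForm (p a) k F) ∈ polyFun ℂ σ := by
  simp only [gradForm_apply]
  exact eval_comp_mem_polyFun (p := fun k a => p a k) hp _

omit [DecidableEq τ] in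
theorem hessForm_mem_polyFun {d : ℕ} {σ : Type*} {p u v : (σ → ℂ) → τ → ℂ}
    (hp : ∀ k, (fun a => p a k) ∈ polyFun ℂ σ) (hu : ∀ k, (fun a => u a k) ∈ polyFun ℂ σ)
    (hv : ∀ k, (fun a => v a k) ∈ polyFun ℂ σ) (F : Forms τ d) :
    (fun a => hessForm (p a) (u a) (v a) F) ∈ polyFun ℂ σ := by
  simp only [hessForm_apply, eval_dirDeriv_dirDeriv]
  exact sum_mem_polyFun _ fun k _ => mul_mem (hu k) <| sum_mem_polyFun _ fun l _ =>
    mul_mem (hv l) (eval_comp_mem_polyFun (p := fun k a => p a k) hp _)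

/-! ### Double points of small rank -/

/-- The conditions on a form to have zero gradient at `p` and to have the vectors `w j` in the
kernel of its Hessian, tested on the vectors `w j` and `f s`. As the Hessian is symmetric, the
values on pairs of the `w j` are indexed by unordered pairs. -/
def doublePointForms {α β : Type*} (d : ℕ) (p : τ → ℂ) (w : α → τ → ℂ) (f : β → τ → ℂ) :
    τ ⊕ Sym2 α ⊕ α × β → Module.Dual ℂ (Forms τ d)
  | .inl k => gradForm p k
  | .inr (.inl z) => hessForm p (w z.out.1) (w z.out.2)
  | .inr (.inr (j, s)) => hessForm p (f s) (w j)

theorem linearIndependent_doublePointForms {α β : Type*} [Fintype α] [DecidableEq α] [Fintype β]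
    [DecidableEq β] {e : ℕ} {p : τ → ℂ} {w : α → τ → ℂ} {f : β → τ → ℂ}
    (l : Module.Dual ℂ (τ → ℂ)) (hlp : l p = 1)
    (m : α → Module.Dual ℂ (τ → ℂ)) (hmp : ∀ j, m j p = 0)
    (hmw : ∀ i j, m i (w j) = if i = j then 1 else 0) (hmf : ∀ i s, m i (f s) = 0)
    (m' : β → Module.Dual ℂ (τ → ℂ)) (hm'p : ∀ s, m' s p = 0) (hm'w : ∀ s j, m' s (w j) = 0)
    (hm'f : ∀ r s, m' r (f s) = if r = s then 1 else 0) :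
    LinearIndependent ℂ (doublePointForms (e + 2) p w f) := by
  have hp : p ≠ 0 := by
    rintro rfl
    simp at hlp
  rw [Fintype.linearIndependent_iff]
  intro g hg
  have hl : ∀ k, (linPoly l ^ k).IsHomogeneous k := fun k => by
    simpa using (linPoly_isHomogeneous l).pow k
  -- Test on the forms `l ^ e * m₁ * m₂` with `m₁` and `m₂` vanishing at `p`.
  have htest : ∀ m₁ m₂ : Module.Dual ℂ (τ → ℂ), m₁ p = 0 → m₂ p = 0 →
      (∑ z : Sym2 α, g (.inr (.inl z)) *
        (m₁ (w z.out.1) * m₂ (w z.out.2) + m₁ (w z.out.2) * m₂ (w z.out.1))) +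
      (∑ x : α × β, g (.inr (.inr x)) *
        (m₁ (f x.2) * m₂ (w x.1) + m₁ (w x.1) * m₂ (f x.2))) = 0 := by
    intro m₁ m₂ h₁ h₂
    have hF : (linPoly l ^ e * (linPoly m₁ * linPoly m₂)).IsHomogeneous (e + 2) :=
      (hl e).mul ((linPoly_isHomogeneous m₁).mul (linPoly_isHomogeneous m₂))
    have hgrad : ∀ k, MvPolynomial.eval p (MvPolynomial.pderiv k
        (linPoly l ^ e * (linPoly m₁ * linPoly m₂))) = 0 := by
      intro k
      simp [h₁, h₂]
    have hhess : ∀ u v, MvPolynomial.eval p (dirDeriv u (dirDeriv v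
        (linPoly l ^ e * (linPoly m₁ * linPoly m₂)))) = m₁ u * m₂ v + m₁ v * m₂ u := by
      intro u v
      have hC : ∀ c : ℂ, dirDeriv u (MvPolynomial.C c) = 0 := (dirDeriv u).map_algebraMap
      simp only [Derivation.leibniz, dirDeriv_linPoly, smul_eq_mul, map_add, map_mul,
        eval_linPoly, h₁, h₂, map_pow, hlp, one_pow, MvPolynomial.eval_C, hC]
      ring
    have := LinearMap.congr_fun hg ⟨_, hF⟩
    simpa only [Fintype.sum_sum_type, LinearMap.add_apply, LinearMap.sum_apply,
      LinearMap.smul_apply, doublePointForms, gradForm_apply, hessForm_apply, hgrad, hhess,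
      smul_eq_mul, mul_zero, Finset.sum_const_zero, zero_add, LinearMap.zero_apply] using this
  have hpairs : ∀ x, g (.inr (.inr x)) = 0 := by
    rintro ⟨j, s⟩
    have := htest (m j) (m' s) (hmp j) (hm'p s)
    simp only [hm'w, hmf, hm'f, hmw, mul_zero, add_zero, Finset.sum_const_zero, zero_add]
      at this
    rw [Fintype.sum_eq_single (j, s)] at this
    · simpa using this
    · rintro ⟨j', s'⟩ hne
      by_cases hj : j = j'
      · rw [if_neg (fun hs : s = s' => hne (by rw [hj, hs])), mul_zero, mul_zero]
      · rw [if_neg hj, zero_mul, mul_zero]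
  have hsym : ∀ z, g (.inr (.inl z)) = 0 := by
    intro z
    have := htest (m z.out.1) (m z.out.2) (hmp _) (hmp _)
    simp only [hpairs, zero_mul, Finset.sum_const_zero, add_zero, hmw] at this
    rw [Fintype.sum_eq_single z] at this
    · refine (mul_eq_zero.1 this).resolve_right ?_
      rw [if_pos rfl, if_pos rfl]
      split_ifs <;> norm_num
    · intro z' hne
      have hz : ∀ y : Sym2 α, s(y.out.1, y.out.2) = y := fun y => Quot.out_eq y
      rw [ite_zero_mul_ite_zero, ite_zero_mul_ite_zero, if_neg, if_neg, add_zero, mul_zero]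
      · rintro ⟨h₁, h₂⟩
        exact hne (by rw [← hz z, ← hz z', h₁, h₂, Sym2.eq_swap])
      · rintro ⟨h₁, h₂⟩
        exact hne (by rw [← hz z, ← hz z', h₁, h₂])
  have hgrad : ∀ k, g (.inl k) = 0 := by
    by_contra! h
    have hv : (fun k => g (.inl k)) ≠ 0 := fun h0 => h.elim fun k hk => hk (congrFun h0 k)
    obtain ⟨q, hq, hne⟩ := exists_quadric_dirDeriv_ne_zero (hl e) hp hv (by simp [hlp])
    apply hne
    have := LinearMap.congr_fun hg ⟨q * linPoly l ^ e, by
      rw [add_comm]; exact hq.mul (hl e)⟩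
    rw [eval_dirDeriv]
    simpa only [Fintype.sum_sum_type, LinearMap.add_apply, LinearMap.sum_apply,
      LinearMap.smul_apply, doublePointForms, gradForm_apply, hpairs, hsym,
      smul_eq_mul, zero_smul, Finset.sum_const_zero, add_zero, LinearMap.zero_apply] using this
  rintro (k | z | x)
  · exact hgrad k
  · exact hsym z
  · exact hpairs x

end Derivatives

section Rank

/-- A reduced echelon basis of `n` vectors in the kernel of a square matrix of size `n + 2` and
rank at most `2`. -/
theorem exists_echelon_kernel {n : ℕ} (H : Matrix (Fin (n + 2)) (Fin (n + 2)) ℂ)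
    (hH : H.rank ≤ 2) : ∃ (E : Fin n ⊕ Fin 2 ≃ Fin (n + 2)) (w : Fin n → Fin (n + 2) → ℂ),
      ∀ j, H.mulVec (w j) = 0 ∧ ∀ j', w j (E (.inl j')) = if j' = j then 1 else 0 := by
  classical
  have hker : n ≤ Module.finrank ℂ (LinearMap.ker H.mulVecLin) := by
    have := LinearMap.finrank_range_add_finrank_ker H.mulVecLin
    rw [Module.finrank_fin_fun] at this
    rw [Matrix.rank] at hH
    omega
  obtain ⟨v, hv⟩ := exists_linearIndependent_of_le_finrank hker
  let B : Matrix (Fin n) (Fin (n + 2)) ℂ := Matrix.of fun j => (v j : Fin (n + 2) → ℂ)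
  have hB : LinearIndependent ℂ B.row :=
    hv.map' (Submodule.subtype _) (Submodule.ker_subtype _)
  obtain ⟨e, he⟩ := exists_submatrix_det_ne_zero B hB
  have hinj : Function.Injective e := by
    intro s t hst
    by_contra hne
    exact he (Matrix.det_zero_of_column_eq hne fun r => by simp [hst])
  have hcard : Fintype.card {t // t ∉ Set.range e} = Fintype.card (Fin 2) := by
    rw [Fintype.card_subtype_compl, Fintype.card_fin, Fintype.card_fin,
      show Fintype.card {t // t ∈ Set.range e} = n from
        (Set.card_range_of_injective hinj).trans (Fintype.card_fin n)]
    omega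
  let E : Fin n ⊕ Fin 2 ≃ Fin (n + 2) :=
    ((Equiv.ofInjective e hinj).sumCongr (Fintype.equivOfCardEq hcard).symm).trans
      (Equiv.Set.sumCompl (Set.range e))
  have hE : ∀ j, E (.inl j) = e j := by
    intro j
    exact Equiv.Set.sumCompl_apply_inl _ _
  set C := B.submatrix id e with hC
  have hunit : IsUnit C.det := isUnit_iff_ne_zero.2 he
  refine ⟨E, fun j => (C⁻¹ * B).row j, fun j => ⟨?_, fun j' => ?_⟩⟩
  · have hBv : ∀ k, H.mulVec (B.row k) = 0 := fun k => (v k).2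
    have : (C⁻¹ * B).row j = ∑ k, C⁻¹ j k • B.row k := by
      ext t
      simp [Matrix.row, Matrix.mul_apply]
    change H.mulVec ((C⁻¹ * B).row j) = 0
    rw [this, Matrix.mulVec_sum]
    exact Finset.sum_eq_zero fun k _ => by rw [Matrix.mulVec_smul, hBv, smul_zero]
  · rw [hE]
    have : (C⁻¹ * B).submatrix id e = 1 := by
      rw [← Matrix.nonsing_inv_mul C hunit]
      rfl
    have := congrFun (congrFun this j) j'
    rw [Matrix.one_apply] at this
    simp only [eq_comm (a := j')]
    exact this

variable {n : ℕ}

/-- The point with `i`-th coordinate `1` and other coordinates given by the parameters. -/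
def paramPoint (i : Fin (n + 2 + 1)) (a : Fin (n + 2) ⊕ Fin n × Fin 2 → ℂ) :
    Fin (n + 2 + 1) → ℂ :=
  i.insertNth (α := fun _ => ℂ) 1 (fun t => a (.inl t))

/-- The vectors of a reduced echelon basis in the hyperplane where the `i`-th coordinate vanishes;
the pivots and the remaining two coordinates are given by the equivalence `E`. -/
def paramKernel (i : Fin (n + 2 + 1)) (E : Fin n ⊕ Fin 2 ≃ Fin (n + 2))
    (a : Fin (n + 2) ⊕ Fin n × Fin 2 → ℂ) (j : Fin n) : Fin (n + 2 + 1) → ℂ :=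
  i.insertNth (α := fun _ => ℂ) 0 fun t =>
    Sum.elim (fun j' => if j' = j then 1 else 0) (fun s => a (.inr (j, s))) (E.symm t)

/-- The unit vectors of the two coordinates that are neither the `i`-th one nor pivots. -/
def freeVector (i : Fin (n + 2 + 1)) (E : Fin n ⊕ Fin 2 ≃ Fin (n + 2)) (s : Fin 2) :
    Fin (n + 2 + 1) → ℂ :=
  i.insertNth (α := fun _ => ℂ) 0 fun t =>
    Sum.elim (fun _ => 0) (fun s' => if s' = s then 1 else 0) (E.symm t)

theorem linearIndependent_paramForms (e : ℕ) (i : Fin (n + 2 + 1))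
    (E : Fin n ⊕ Fin 2 ≃ Fin (n + 2)) (a : Fin (n + 2) ⊕ Fin n × Fin 2 → ℂ) :
    LinearIndependent ℂ (doublePointForms (e + 2) (paramPoint i a) (paramKernel i E a)
      (freeVector i E)) := by
  let x : Fin (n + 2) → Module.Dual ℂ (Fin (n + 2 + 1) → ℂ) := fun t =>
    LinearMap.proj (i.succAbove t) - a (.inl t) • LinearMap.proj i
  have hx : ∀ t v, x t v = v (i.succAbove t) - a (.inl t) * v i := by
    intro t v
    simp [x]
  refine linearIndependent_doublePointForms (LinearMap.proj i) (by simp [paramPoint])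
    (fun j => x (E (.inl j))) ?_ ?_ ?_
    (fun s => x (E (.inr s)) - ∑ j, a (.inr (j, s)) • x (E (.inl j))) ?_ ?_ ?_
  · intro j
    simp [hx, paramPoint]
  · intro j j'
    simp [hx, paramKernel]
  · intro j s
    simp [hx, freeVector]
  · intro s
    simp [hx, paramPoint]
  · intro s j
    simp [hx, paramKernel, LinearMap.sum_apply]
  · intro r s
    simp [hx, freeVector, LinearMap.sum_apply]

theorem insertNth_mem_polyFun {σ : Type*} {N : ℕ} (i : Fin (N + 1)) {f : (σ → ℂ) → ℂ}
    {g : (σ → ℂ) → Fin N → ℂ} (hf : f ∈ polyFun ℂ σ) (hg : ∀ t, (fun a => g a t) ∈ polyFun ℂ σ)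
    (k : Fin (N + 1)) :
    (fun a => i.insertNth (α := fun _ => ℂ) (f a) (g a) k) ∈ polyFun ℂ σ := by
  induction k using Fin.succAboveCases i with
  | x => simpa using hf
  | p k => simpa using hg k

/-- The hypersurfaces of degree `e + 2` with a double point whose quadratic part has rank at most
`2`, with the point and the kernel of the quadratic part in fixed coordinate charts. -/
def smallRankLocus (n e : ℕ) (i : Fin (n + 2 + 1)) (E : Fin n ⊕ Fin 2 ≃ Fin (n + 2)) :
    Set (Hypersurfaces (n + 2) (e + 2)) :=
  {x | ∃ a : Fin (n + 2) ⊕ Fin n × Fin 2 → ℂ,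
    LinearIndependent ℂ (doublePointForms (e + 2) (paramPoint i a) (paramKernel i E a)
      (freeVector i E)) ∧
    ∀ r, doublePointForms (e + 2) (paramPoint i a) (paramKernel i E a) (freeVector i E) r
      x.rep = 0}

theorem le_codim_smallRankLocus (e : ℕ) (i : Fin (n + 2 + 1))
    (E : Fin n ⊕ Fin 2 ≃ Fin (n + 2)) :
    ((n * (n + 1) / 2 + 1 : ℕ) : ℕ∞) ≤ codim (closure (smallRankLocus n e i E)) := by
  refine le_codim_of_linearConditions
    (fun r a => doublePointForms (e + 2) (paramPoint i a) (paramKernel i E a) (freeVector i E) r)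
    ?_ _ ?_
  · have hp : ∀ k, (fun a => paramPoint (n := n) i a k) ∈ polyFun ℂ _ :=
      insertNth_mem_polyFun i (const_mem_polyFun _) fun t => coord_mem_polyFun _
    have hw : ∀ j k, (fun a => paramKernel i E a j k) ∈ polyFun ℂ _ := by
      refine fun j => insertNth_mem_polyFun i (const_mem_polyFun _) fun t => ?_
      rcases E.symm t with j' | s
      · exact const_mem_polyFun _
      · exact coord_mem_polyFun _
    rintro (k | z | ⟨j, s⟩) F
    · exact gradForm_mem_polyFun (p := paramPoint i) hp k F
    · exact hessForm_mem_polyFun (p := paramPoint i) (u := fun a => paramKernel i E a z.out.1)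
        (v := fun a => paramKernel i E a z.out.2) hp (hw _) (hw _) F
    · exact hessForm_mem_polyFun (p := paramPoint i) (u := fun _ => freeVector i E s)
        (v := fun a => paramKernel i E a j) hp (fun k => const_mem_polyFun _) (hw _) F
  · simp only [Fintype.card_sum, Fintype.card_fin, Fintype.card_prod, Sym2.card,
      Nat.choose_two_right, Nat.add_sub_cancel, mul_comm (n + 1) n]
    omega

/-! ### The quadratic part of the local equation -/

section LocalEquation

open MvPolynomial

theorem pderiv_aeval_insertNth {N : ℕ} (i : Fin (N + 1)) (c : Fin N → ℂ)
    (F : MvPolynomial (Fin (N + 1)) ℂ) (j : Fin N) :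
    pderiv j (aeval (i.insertNth (α := fun _ => MvPolynomial (Fin N) ℂ) 1
      (fun j => X j + C (c j))) F) =
    aeval (i.insertNth (α := fun _ => MvPolynomial (Fin N) ℂ) 1
      (fun j => X j + C (c j))) (pderiv (i.succAbove j) F) := by
  classical
  induction F using MvPolynomial.induction_on with
  | C r => simp [MvPolynomial.algebraMap_eq]
  | add p q hp hq => rw [map_add, map_add, hp, hq, map_add, map_add]
  | mul_X p k hp =>
    rw [map_mul, pderiv_mul, hp, pderiv_mul, map_add, map_mul, map_mul, aeval_X]
    congr 2
    induction k using Fin.succAboveCases i with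
    | x => simp [(Fin.succAbove_ne i j).symm]
    | p k => simp [pderiv_X, Pi.single_apply, apply_ite]

theorem coeff_zero_aeval_insertNth {N : ℕ} (i : Fin (N + 1)) (c : Fin N → ℂ)
    (F : MvPolynomial (Fin (N + 1)) ℂ) :
    coeff 0 (aeval (i.insertNth (α := fun _ => MvPolynomial (Fin N) ℂ) 1
      (fun j => X j + C (c j))) F) = eval (i.insertNth (α := fun _ => ℂ) 1 c) F := by
  rw [← constantCoeff_eq, aeval_def, hom_eval₂, ← eval₂_id]
  congr 1
  · ext; simp
  · ext k
    induction k using Fin.succAboveCases i with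
    | x => simp
    | p k => simp

theorem coeff_zero_pderiv_pderiv_homogeneousComponent {N : ℕ} (G : MvPolynomial (Fin N) ℂ)
    (j k : Fin N) :
    coeff 0 (pderiv j (pderiv k (homogeneousComponent 2 G))) = coeff 0 (pderiv j (pderiv k G)) := by
  simp [coeff_pderiv, coeff_homogeneousComponent]

theorem homogeneousComponent_one_eq_zero {N : ℕ} {G : MvPolynomial (Fin N) ℂ}
    (h : ∀ j, coeff 0 (pderiv j G) = 0) : homogeneousComponent 1 G = 0 := by
  ext m
  rw [coeff_homogeneousComponent, coeff_zero]
  split_ifs with hm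
  · obtain ⟨j, rfl⟩ : m ∈ Set.range fun j : Fin N => Finsupp.single j 1 := by
      rw [Finsupp.range_single_one]
      exact hm
    simpa [coeff_pderiv] using h j
  · rfl

end LocalEquation

theorem equation_isHomogeneous {M d : ℕ} (W : Hypersurfaces M d) : (equation W).IsHomogeneous d :=
  W.rep.2

/-- A singular point that is not a quadratic singularity of rank at least `3` puts the hypersurface
in one of the loci of small rank. -/
theorem exists_mem_smallRankLocus {e : ℕ} {W : Hypersurfaces (n + 2) (e + 2)}
    {p : ProjSpace (n + 2)} (hp : p ∈ singularPoints W)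
    (hbad : ¬ ∃ r : ℕ, 3 ≤ r ∧ IsQuadraticSingularity W p r) :
    ∃ i E, W ∈ smallRankLocus n e i E := by
  obtain ⟨i, hi⟩ : ∃ i, p.rep i ≠ 0 := by
    by_contra! h
    exact p.rep_nonzero (funext h)
  set c : Fin (n + 2) → ℂ := fun t => p.rep (i.succAbove t) / p.rep i with hc
  set q : Fin (n + 2 + 1) → ℂ := i.insertNth (α := fun _ => ℂ) 1 c with hq
  have hqp : q = (p.rep i)⁻¹ • p.rep := by
    ext k
    induction k using Fin.succAboveCases i with
    | x => simp [hq, hi]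
    | p k => simp [hq, hc, div_eq_inv_mul]
  have hF := equation_isHomogeneous W
  have h0 : MvPolynomial.eval q (equation W) = 0 := by
    rw [hqp, eval_smul_of_isHomogeneous hF, hp.1, mul_zero]
  have h1 : ∀ k, MvPolynomial.eval q (MvPolynomial.pderiv k (equation W)) = 0 := by
    intro k
    rw [hqp, eval_smul_of_isHomogeneous hF.pderiv, hp.2, mul_zero]
  set H : Matrix (Fin (n + 2)) (Fin (n + 2)) ℂ := Matrix.of fun j k => MvPolynomial.eval q
    (MvPolynomial.pderiv (i.succAbove j) (MvPolynomial.pderiv (i.succAbove k) (equation W)))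
    with hH
  have hrank : quadraticRank (MvPolynomial.homogeneousComponent 2 (localEquation W p i)) =
      H.rank := by
    rw [quadraticRank]
    congr 1
    ext j k
    simp only [Matrix.of_apply, hH]
    rw [coeff_zero_pderiv_pderiv_homogeneousComponent, localEquation, pderiv_aeval_insertNth,
      pderiv_aeval_insertNth, coeff_zero_aeval_insertNth]
  have hle : H.rank ≤ 2 := by
    by_contra! hlt
    refine hbad ⟨H.rank, hlt, i, hi, ?_, ?_, ?_, hrank⟩
    · rw [MvPolynomial.homogeneousComponent_zero, localEquation, coeff_zero_aeval_insertNth, h0,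
        map_zero]
    · refine homogeneousComponent_one_eq_zero fun j => ?_
      rw [localEquation, pderiv_aeval_insertNth, coeff_zero_aeval_insertNth, h1]
    · intro hzero
      rw [hzero] at hrank
      have : quadraticRank (0 : MvPolynomial (Fin (n + 2)) ℂ) = 0 := by
        rw [quadraticRank]
        convert Matrix.rank_zero (R := ℂ) (m := Fin (n + 2)) (n := Fin (n + 2)) using 2
        ext j k
        simp
      omega
  obtain ⟨E, w, hw⟩ := exists_echelon_kernel H hle
  let a : Fin (n + 2) ⊕ Fin n × Fin 2 → ℂ := Sum.elim c fun x => w x.1 (E (.inr x.2))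
  have hpa : paramPoint i a = q := rfl
  have hwa : ∀ j, paramKernel i E a j = i.insertNth (α := fun _ => ℂ) 0 (w j) := by
    intro j
    rw [paramKernel]
    congr 1
    ext t
    obtain ⟨t, rfl⟩ := E.surjective t
    rw [E.symm_apply_apply]
    rcases t with j' | s
    · exact ((hw j).2 j').symm
    · rfl
  -- The vectors `w j` are in the kernel of the Hessian on the hyperplane `x i = 0`.
  have hker : ∀ (u : Fin (n + 2) → ℂ) (j : Fin n),
      MvPolynomial.eval q (dirDeriv (i.insertNth (α := fun _ => ℂ) 0 u)
        (dirDeriv (i.insertNth (α := fun _ => ℂ) 0 (w j)) (equation W))) = 0 := by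
    intro u j
    rw [eval_dirDeriv_dirDeriv]
    simp only [Fin.sum_univ_succAbove _ i, Fin.insertNth_apply_same,
      Fin.insertNth_apply_succAbove, zero_mul, zero_add]
    refine Finset.sum_eq_zero fun k _ => ?_
    have := congrFun (hw j).1 k
    rw [Matrix.mulVec, dotProduct] at this
    rw [mul_eq_zero]
    right
    exact Eq.trans (Finset.sum_congr rfl fun l _ => mul_comm _ _) this
  refine ⟨i, E, a, linearIndependent_paramForms e i E a, ?_⟩
  rintro (k | z | ⟨j, s⟩)
  · rw [doublePointForms, gradForm_apply, hpa]
    exact h1 k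
  · rw [doublePointForms, hessForm_apply, hpa, hwa, hwa]
    exact hker _ _
  · rw [doublePointForms, hessForm_apply, hpa, hwa]
    exact hker _ _

end Rank

/-! ### Points in general position on an infinite subset of a projective space -/

section GeneralPosition

/-- An infinite subset of a projective space contains arbitrarily many points in linear general
position in a linear subspace of positive dimension: it suffices to take a subspace of the smallest
dimension containing infinitely many points of the set, and to choose the points one by one. -/
theorem exists_finset_general_position {K V : Type*} [Field K] [AddCommGroup V] [Module K V]
    [FiniteDimensional K V] {S : Set (ℙ K V)} (hS : S.Infinite) :
    ∃ (k : ℕ) (Λ : Submodule K V), 1 ≤ k ∧ Module.finrank K Λ = k + 1 ∧ ∀ N : ℕ,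
      ∃ T : Finset V, T.card = N ∧ (∀ v ∈ T, v ∈ Λ ∧ ∃ x ∈ S, v = x.rep) ∧
        ∀ A ⊆ T, A.card ≤ k + 1 → LinearIndepOn K id (A : Set V) := by
  classical
  let P : ℕ → Prop := fun m => ∃ Λ : Submodule K V, Module.finrank K Λ = m ∧
    {x : ℙ K V | x ∈ S ∧ x.rep ∈ Λ}.Infinite
  have hP : ∃ m, P m := ⟨_, ⊤, rfl, by simpa using hS⟩
  obtain ⟨Λ, hΛ, hinf⟩ := Nat.find_spec hP
  have hmin : ∀ Λ' : Submodule K V, Module.finrank K Λ' < Nat.find hP →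
      {x : ℙ K V | x ∈ S ∧ x.rep ∈ Λ'}.Finite := by
    intro Λ' hlt
    by_contra h
    exact Nat.find_min hP hlt ⟨Λ', rfl, h⟩
  have htwo : 2 ≤ Nat.find hP := by
    obtain ⟨x, hx, y, hy, hxy⟩ := hinf.nontrivial
    have hind := Projectivization.independent_iff.1
      ((Projectivization.independent_pair_iff_ne x y).2 hxy)
    have hle : Submodule.span K (Set.range (Projectivization.rep ∘ ![x, y])) ≤ Λ := by
      rw [Submodule.span_le]
      rintro _ ⟨i, rfl⟩
      fin_cases i
      · exact hx.2
      · exact hy.2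
    have := Submodule.finrank_mono hle
    rw [finrank_span_eq_card hind, Fintype.card_fin, hΛ] at this
    exact this
  refine ⟨Nat.find hP - 1, Λ, by omega, by omega, fun N => ?_⟩
  set k := Nat.find hP - 1 with hk
  induction N with
  | zero =>
    refine ⟨∅, rfl, by simp, fun A hA _ => ?_⟩
    rw [Finset.subset_empty.1 hA]
    simp
  | succ N ih =>
    obtain ⟨T, hTN, hTS, hT⟩ := ih
    -- Avoid the finitely many points of the set on the proper subspaces spanned by the points
    -- already chosen.
    obtain ⟨x, ⟨hxS, hxΛ⟩, hx⟩ : ∃ x ∈ {x : ℙ K V | x ∈ S ∧ x.rep ∈ Λ},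
        x ∉ ⋃ A ∈ T.powerset.filter fun A => A.card ≤ k,
          {x : ℙ K V | x ∈ S ∧ x.rep ∈ Submodule.span K (A : Set V)} := by
      refine (hinf.sdiff (Set.Finite.biUnion (Finset.finite_toSet _) fun A hA => ?_)).nonempty
      refine hmin _ ?_
      have h1 := finrank_span_finset_le_card (R := K) A
      have h2 := (Finset.mem_filter.1 hA).2
      rw [Set.finrank] at h1
      omega
    have hxA : ∀ A ⊆ T, A.card ≤ k → x.rep ∉ Submodule.span K (A : Set V) := by
      intro A hA hcard hmem
      refine hx (Set.mem_biUnion (x := A) ?_ ⟨hxS, hmem⟩)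
      exact Finset.mem_filter.2 ⟨Finset.mem_powerset.2 hA, hcard⟩
    have hxT : x.rep ∉ T := by
      intro h
      refine hxA {x.rep} (by simpa using h) (by rw [Finset.card_singleton]; omega) ?_
      exact Submodule.subset_span (by simp)
    refine ⟨insert x.rep T, by rw [Finset.card_insert_of_notMem hxT, hTN], ?_, ?_⟩
    · intro v hv
      rcases Finset.mem_insert.1 hv with rfl | hv
      · exact ⟨hxΛ, x, hxS, rfl⟩
      · exact hTS v hv
    · intro A hA hcard
      by_cases hxm : x.rep ∈ A
      · have hA' : A.erase x.rep ⊆ T := by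
          rw [← Finset.subset_insert_iff]
          exact hA
        have hcard' : (A.erase x.rep).card ≤ k := by
          rw [Finset.card_erase_of_mem hxm]
          omega
        rw [← Finset.insert_erase hxm, Finset.coe_insert]
        refine (hT _ hA' (by omega)).id_insert ?_
        exact hxA _ hA' hcard'
      · exact hT A ((Finset.subset_insert_iff_of_notMem hxm).1 hA) hcard

end GeneralPosition

/-! ### Hypersurfaces with many double points -/

section DoublePoints

variable {τ ι : Type*} [Fintype τ] [DecidableEq τ] [Fintype ι] [DecidableEq ι]

/-- Double points at `k * g + 1` points, none of which is in the span of `k` others, impose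
independent conditions on forms of degree `2 * g + 2`: the points other than a given one lie on `g`
hyperplanes not containing it, and the product of the squares of the equations of these hyperplanes
with quadratic forms has arbitrary gradient at the given point. -/
theorem linearIndependent_gradForm {k g : ℕ} {v : ι → τ → ℂ} (hcard : Fintype.card ι = k * g + 1)
    (hv : ∀ x (A : Finset ι), A.card ≤ k → x ∉ A → v x ∉ Submodule.span ℂ (v '' A)) :
    LinearIndependent ℂ (fun r : ι × τ => gradForm (d := 2 * g + 2) (v r.1) r.2) := by
  rw [Fintype.linearIndependent_iff]
  intro c hc
  by_contra! h
  obtain ⟨⟨x, i⟩, hxi⟩ := h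
  have hvx : v x ≠ 0 := fun h0 => hv x ∅ (by simp) (by simp) (by rw [h0]; exact zero_mem _)
  have hcx : (fun i => c (x, i)) ≠ 0 := fun h0 => hxi (congrFun h0 i)
  let e : {y // y ≠ x} ≃ Fin g × Fin k := Fintype.equivOfCardEq (by
    rw [Fintype.card_subtype_compl, hcard, Fintype.card_prod, Fintype.card_fin, Fintype.card_fin,
      Fintype.card_subtype_eq, Nat.add_sub_cancel, mul_comm])
  have hl : ∀ s : Fin g, ∃ l : Module.Dual ℂ (τ → ℂ), l (v x) ≠ 0 ∧
      ∀ t : Fin k, l (v (e.symm (s, t))) = 0 := by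
    intro s
    obtain ⟨l, hlx, hl⟩ := Submodule.exists_le_ker_of_notMem
      (hv x (Finset.univ.image fun t : Fin k => (e.symm (s, t) : ι))
        (Finset.card_image_le.trans (by simp)) (by
          simp only [Finset.mem_image, Finset.mem_univ, true_and, not_exists]
          exact fun t => (e.symm (s, t)).2))
    refine ⟨l, hlx, fun t => hl (Submodule.subset_span ⟨_, ?_, rfl⟩)⟩
    simp
  choose l hlx hl using hl
  have hG : (∏ s, linPoly (l s) ^ 2).IsHomogeneous (2 * g) := by
    have := MvPolynomial.IsHomogeneous.prod Finset.univ (fun s => linPoly (l s) ^ 2)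
      (fun _ => 1 * 2) fun s _ => (linPoly_isHomogeneous (l s)).pow 2
    simpa [mul_comm] using this
  obtain ⟨q, hq, hne⟩ := exists_quadric_dirDeriv_ne_zero hG hvx hcx (by
    simpa [Finset.prod_eq_zero_iff] using hlx)
  have hzero : ∀ y ≠ x, ∀ j, MvPolynomial.eval (v y)
      (MvPolynomial.pderiv j (q * ∏ s, linPoly (l s) ^ 2)) = 0 := by
    intro y hy j
    have h0 := hl (e ⟨y, hy⟩).1 (e ⟨y, hy⟩).2
    rw [Prod.mk.eta, e.symm_apply_apply] at h0
    rw [← Finset.mul_prod_erase Finset.univ _ (Finset.mem_univ (e ⟨y, hy⟩).1)]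
    simp [h0, pow_two]
  have := LinearMap.congr_fun hc ⟨q * ∏ s, linPoly (l s) ^ 2, by
    rw [add_comm]; exact hq.mul hG⟩
  simp only [LinearMap.sum_apply, LinearMap.smul_apply, gradForm_apply, smul_eq_mul,
    LinearMap.zero_apply, Fintype.sum_prod_type] at this
  rw [Fintype.sum_eq_single x fun y hy => Finset.sum_eq_zero fun j _ => by
    rw [hzero y hy, mul_zero], ← eval_dirDeriv] at this
  exact hne this

/-- Points in a linear subspace of dimension `k`, with the vectors of a basis and the normalized
coordinates of the other points as parameters. -/
def paramPoints (k m : ℕ) (a : Fin (k + 1) × τ ⊕ Fin m × Fin k → ℂ) :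
    Fin (k + 1) ⊕ Fin m → τ → ℂ
  | .inl t => fun i => a (.inl (t, i))
  | .inr y => fun i => a (.inl (0, i)) + ∑ s : Fin k, a (.inr (y, s)) * a (.inl (s.succ, i))

omit [Fintype τ] [DecidableEq τ] in
theorem paramPoints_mem_polyFun (k m : ℕ) (x : Fin (k + 1) ⊕ Fin m) (i : τ) :
    (fun a => paramPoints k m a x i) ∈ polyFun ℂ _ := by
  rcases x with t | y
  · exact coord_mem_polyFun _
  · exact add_mem (coord_mem_polyFun _) (sum_mem_polyFun _ fun s _ =>
      mul_mem (coord_mem_polyFun _) (coord_mem_polyFun _))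

/-- The hypersurfaces with double points at certain `k * (n + 1) + 1` points of a linear subspace of
dimension `k`, imposing independent conditions. -/
def manyDoublePointsLocus (n d k : ℕ) : Set (Hypersurfaces (n + 2) d) :=
  {W | ∃ a : Fin (k + 1) × Fin (n + 2 + 1) ⊕ Fin (k * n) × Fin k → ℂ,
    LinearIndependent ℂ (fun r : (Fin (k + 1) ⊕ Fin (k * n)) × Fin (n + 2 + 1) =>
      gradForm (d := d) (paramPoints k (k * n) a r.1) r.2) ∧
    ∀ r : (Fin (k + 1) ⊕ Fin (k * n)) × Fin (n + 2 + 1),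
      gradForm (d := d) (paramPoints k (k * n) a r.1) r.2 W.rep = 0}

theorem le_codim_manyDoublePointsLocus {n k : ℕ} (d : ℕ) (hn : 1 ≤ n) (hk : k < n + 2) :
    ((n * (n + 1) / 2 + 1 : ℕ) : ℕ∞) ≤ codim (closure (manyDoublePointsLocus n d (k + 1))) := by
  refine le_codim_of_linearConditions
    (fun (r : (Fin (k + 1 + 1) ⊕ Fin ((k + 1) * n)) × Fin (n + 2 + 1))
      (a : Fin (k + 1 + 1) × Fin (n + 2 + 1) ⊕ Fin ((k + 1) * n) × Fin (k + 1) → ℂ) =>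
      gradForm (d := d) (paramPoints (k + 1) ((k + 1) * n) a r.1) r.2) ?_ _ ?_
  · rintro ⟨x, i⟩ F
    exact gradForm_mem_polyFun (p := fun a => paramPoints (k + 1) ((k + 1) * n) a x)
      (paramPoints_mem_polyFun _ _ _) i F
  · simp only [Fintype.card_sum, Fintype.card_fin, Fintype.card_prod]
    obtain ⟨j, hj⟩ : ∃ j, k + j = n + 1 := ⟨n + 1 - k, by omega⟩
    have h1 : n * (n + 1) / 2 + 1 ≤ (k + 1) * n * (j + 1) := by
      have h2 : n + 2 ≤ (k + 1) * (j + 1) := by nlinarith [Nat.zero_le (k * j)]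
      have h3 : n * (n + 2) ≤ (k + 1) * n * (j + 1) := by
        calc n * (n + 2) ≤ n * ((k + 1) * (j + 1)) := Nat.mul_le_mul_left n h2
          _ = _ := by ring
      have h4 : n * (n + 2) = n * (n + 1) + n := by ring
      have h5 : 2 ≤ n * (n + 1) := by nlinarith
      omega
    have h6 : (k + 1 + 1 + (k + 1) * n) * (n + 2 + 1) = (k + 1 + 1) * (n + 2 + 1) +
        (k + 1) * n * (k + 1) + (k + 1) * n * (j + 1) := by
      rw [show n + 2 + 1 = (k + 1) + (j + 1) by omega]
      ring
    rw [h6]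
    omega

/-- A hypersurface with infinitely many singular points is in one of the loci of hypersurfaces with
many double points. -/
theorem exists_mem_manyDoublePointsLocus {n : ℕ} {W : Hypersurfaces (n + 2) (2 * (n + 1) + 2)}
    (hW : (singularPoints W).Infinite) :
    ∃ k < n + 2, W ∈ manyDoublePointsLocus n (2 * (n + 1) + 2) (k + 1) := by
  classical
  obtain ⟨k, Λ, hk, hΛ, hgen⟩ := exists_finset_general_position hW
  have hkn : k ≤ n + 2 := by
    have := Submodule.finrank_le Λ
    rw [hΛ, Module.finrank_fin_fun] at this
    omega
  obtain ⟨T, hTcard, hTS, hT⟩ := hgen (k + 1 + k * n)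
  let f : Fin (k + 1) ⊕ Fin (k * n) ≃ T := Fintype.equivOfCardEq (by simp [hTcard])
  let v : Fin (k + 1) ⊕ Fin (k * n) → Fin (n + 2 + 1) → ℂ := fun x => f x
  have hvinj : Function.Injective v := Subtype.val_injective.comp f.injective
  have hvT : ∀ A : Finset (Fin (k + 1) ⊕ Fin (k * n)), A.image v ⊆ T := by
    intro A y hy
    obtain ⟨x, -, rfl⟩ := Finset.mem_image.1 hy
    exact (f x).2
  have hind : ∀ A : Finset (Fin (k + 1) ⊕ Fin (k * n)), A.card ≤ k + 1 →
      LinearIndepOn ℂ id (v '' A) := by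
    intro A hA
    rw [← Finset.coe_image]
    exact hT _ (hvT A) (Finset.card_image_le.trans hA)
  have hv : ∀ x (A : Finset (Fin (k + 1) ⊕ Fin (k * n))), A.card ≤ k → x ∉ A →
      v x ∉ Submodule.span ℂ (v '' A) := by
    intro x A hA hxA
    have h1 := hind (insert x A) (by rw [Finset.card_insert_of_notMem hxA]; omega)
    rw [Finset.coe_insert, Set.image_insert_eq, linearIndepOn_id_insert] at h1
    · exact h1.2
    · rintro ⟨y, hy, hyx⟩
      exact hxA (hvinj hyx ▸ hy)
  have hspan : Submodule.span ℂ (Set.range fun t => v (.inl t)) = Λ := by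
    refine Submodule.eq_of_le_of_finrank_eq ?_ ?_
    · rw [Submodule.span_le]
      rintro _ ⟨t, rfl⟩
      exact (hTS _ (f (.inl t)).2).1
    · have h1 := hind (Finset.univ.image Sum.inl) (Finset.card_image_le.trans (by simp))
      rw [Finset.coe_image, Finset.coe_univ, Set.image_univ, ← Set.range_comp,
        linearIndepOn_id_range_iff (hvinj.comp Sum.inl_injective)] at h1
      rw [hΛ]
      exact (finrank_span_eq_card h1).trans (Fintype.card_fin _)
  have hcoord : ∀ y, ∃ c : Fin (k + 1) → ℂ, ∑ t, c t • v (.inl t) = v (.inr y) := by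
    intro y
    rw [← Submodule.mem_span_range_iff_exists_fun, hspan]
    exact (hTS _ (f (.inr y)).2).1
  choose c hc using hcoord
  -- By general position, the normalization dividing by the first coordinate is possible.
  have hc0 : ∀ y, c y 0 ≠ 0 := by
    intro y h0
    refine hv (.inr y) (Finset.univ.image fun s : Fin k => .inl s.succ)
      (Finset.card_image_le.trans (by simp)) (by simp) ?_
    rw [← hc y, Fin.sum_univ_succ, h0, zero_smul, zero_add]
    refine Submodule.sum_mem _ fun s _ => Submodule.smul_mem _ _ (Submodule.subset_span ?_)
    exact ⟨.inl s.succ, by simp, rfl⟩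
  let u : Fin (k + 1) ⊕ Fin (k * n) → ℂ := Sum.elim (fun _ => 1) fun y => (c y 0)⁻¹
  have hu : ∀ x, u x ≠ 0 := by
    rintro (t | y)
    · exact one_ne_zero
    · exact inv_ne_zero (hc0 y)
  let a : Fin (k + 1) × Fin (n + 2 + 1) ⊕ Fin (k * n) × Fin k → ℂ :=
    Sum.elim (fun x => v (.inl x.1) x.2) fun x => (c x.1 0)⁻¹ * c x.1 x.2.succ
  have ha : ∀ x, paramPoints k (k * n) a x = u x • v x := by
    rintro (t | y)
    · ext i
      simp [paramPoints, a, u]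
    · rw [← hc y]
      ext i
      simp only [paramPoints, a, u, Sum.elim_inl, Sum.elim_inr, Fin.sum_univ_succ, Pi.add_apply,
        Pi.smul_apply, smul_eq_mul, Finset.sum_apply, mul_assoc]
      rw [mul_add, inv_mul_cancel_left₀ (hc0 y), Finset.mul_sum]
  obtain ⟨k, rfl⟩ : ∃ k', k = k' + 1 := ⟨k - 1, by omega⟩
  refine ⟨k, by omega, a, ?_, ?_⟩
  · refine linearIndependent_gradForm (k := k + 1) (g := n + 1)
      (v := paramPoints (k + 1) ((k + 1) * n) a) ?_ ?_
    · simp only [Fintype.card_sum, Fintype.card_fin]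
      ring
    · intro x A hA hxA hmem
      have hle : Submodule.span ℂ (paramPoints (k + 1) ((k + 1) * n) a '' A) ≤
          Submodule.span ℂ (v '' A) := by
        rw [Submodule.span_le]
        rintro _ ⟨y, hy, rfl⟩
        rw [ha]
        exact Submodule.smul_mem _ _ (Submodule.subset_span ⟨y, hy, rfl⟩)
      rw [ha] at hmem
      exact hv x A hA hxA ((Submodule.smul_mem_iff _ (hu x)).1 (hle hmem))
  · rintro ⟨x, i⟩
    obtain ⟨-, p, hp, hpv⟩ := hTS _ (f x).2
    have h0 : MvPolynomial.eval (v x) (MvPolynomial.pderiv i (equation W)) = 0 := by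
      rw [show v x = p.rep from hpv]
      exact hp.2 i
    rw [gradForm_apply, ha]
    exact (eval_smul_of_isHomogeneous (equation_isHomogeneous W).pderiv _ _).trans
      (mul_eq_zero_of_right _ h0)

end DoublePoints

end FanoDouble

end

theorem theorem0p4 (M : ℕ) (hM : 4 ≤ M) :
    ∃ Wreg : Set (FanoDouble.Hypersurfaces M (2 * M)),
      IsOpen Wreg ∧
      (∀ W ∈ Wreg,
        (FanoDouble.singularPoints W).Finite ∧
        ∀ p ∈ FanoDouble.singularPoints W,
          ∃ r : ℕ, 3 ≤ r ∧ FanoDouble.IsQuadraticSingularity W p r) ∧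
      (((M - 2) * (M - 1) / 2 + 1 : ℕ) : ℕ∞) ≤ FanoDouble.codim Wregᶜ := by
  obtain ⟨n, rfl⟩ : ∃ n, M = n + 2 := ⟨M - 2, by omega⟩
  change ∃ Wreg : Set (FanoDouble.Hypersurfaces (n + 2) (2 * (n + 1) + 2)), _
  let B : (Fin (n + 2 + 1) × (Fin n ⊕ Fin 2 ≃ Fin (n + 2))) ⊕ Fin (n + 2) →
      Set (FanoDouble.Hypersurfaces (n + 2) (2 * (n + 1) + 2)) :=
    Sum.elim (fun x => FanoDouble.smallRankLocus n (2 * (n + 1)) x.1 x.2)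
      fun k => FanoDouble.manyDoublePointsLocus n (2 * (n + 1) + 2) (k + 1)
  refine ⟨(closure (⋃ x, B x))ᶜ, isClosed_closure.isOpen_compl, fun W hW => ?_, ?_⟩
  · have hW' : ∀ x, W ∉ B x := fun x hx => hW (subset_closure (Set.mem_iUnion.2 ⟨x, hx⟩))
    refine ⟨?_, fun p hp => ?_⟩
    · by_contra hinf
      obtain ⟨k, hk, hWk⟩ := FanoDouble.exists_mem_manyDoublePointsLocus hinf
      exact hW' (.inr ⟨k, hk⟩) hWk
    · by_contra hbad
      obtain ⟨i, E, hWE⟩ := FanoDouble.exists_mem_smallRankLocus hp hbad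
      exact hW' (.inl (i, E)) hWE
  · rw [compl_compl]
    refine FanoDouble.le_codim_closure_iUnion B _ ?_
    rw [show n + 2 - 2 = n by omega, show n + 2 - 1 = n + 1 by omega]
    rintro (⟨i, E⟩ | k)
    · exact FanoDouble.le_codim_smallRankLocus _ i E
    · exact FanoDouble.le_codim_manyDoublePointsLocus _ (by omega) k.2
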